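/- Let $k$ be a field. A linear category is an abelian category with a compatible enrichment in $k$-vector spaces. A linear monoidal category is a monoidal linear category with bilinear tensor product, and a tensor category is a rigid linear monoidal category. A bilinear functor $\mathcal M\times\mathcal N\to\mathcal X$ is called right exact if it is right exact in each variable. A Deligne product of linear categories $\mathcal M$ and $\mathcal N$ is a linear category $\mathcal M\boxtimes\mathcal N$ with a right exact bilinear functor $\boxtimes:\mathcal M\times\mathcal N\to\mathcal M\boxtimes\mathcal N$ such that, for every linear category $\mathcal X$, restriction along $\boxtimes$ is an equivalence from the category of right exact linear functors $\mathcal M\boxtimes\mathcal N\to\mathcal X$ to the category of right exact bilinear functors $\mathcal M\times\mathcal N\to\mathcal X$. Let $\mathcal C$ and $\mathcal D$ be tensor categories over $k$, and let $\mathcal C\boxtimes\mathcal D$ be a Deligne product of them with its induced monoidal structure, that is, a linear monoidal structure whose tensor product is right exact in each variable and for which $\boxtimes:\mathcal C\times\mathcal D\to\mathcal C\boxtimes\mathcal D$ is a (strong) monoidal functor; thus $(c\boxtimes d)\otimes(c'\boxtimes d')\cong(c\otimes c')\boxtimes(d\otimes d')$ coherently. Let $B$ be an algebra object in $\mathcal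 C$ and $B'$ an algebra object in $\mathcal D$, so that $B\boxtimes B'$ is an algebra object in $\mathcal C\boxtimes\mathcal D$. For an algebra object $A$ of a linear monoidal category $\mathcal E$, let $\mathrm{mod}\text{-}A(\mathcal E)$ be the category of right $A$-module objects in $\mathcal E$, with the left $\mathcal E$-action $e\otimes x_A$. Then a Deligne product $\mathrm{mod}\text{-}B(\mathcal C)\boxtimes\mathrm{mod}\text{-}B'(\mathcal D)$ exists. Every such Deligne product carries an induced left $\mathcal C\boxtimes\mathcal D$-action, that is, a left action that is bilinear, right exact in each variable, and equipped with coherent natural isomorphisms $(c\boxtimes d)\otimes(n\boxtimes p)\cong(c\otimes n)\boxtimes(d\otimes p)$. For every such action there is a linear equivalence $$\mathrm{mod}\text{-}B(\mathcal C)\boxtimes\mathrm{mod}\text{-}B'(\mathcal D)\;\simeq\;\mathrm{mod}\text{-}(B\boxtimes B')(\mathcal C\boxtimes\mathcal D)$$ that is a (strong) functor of left $\mathcal C\boxtimes\mathcal D$-module categories. -/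

import Mathlib

open CategoryTheory CategoryTheory.Limits CategoryTheory.MonoidalCategory
open scoped CategoryTheory.MonObj CategoryTheory.MonoidalCategory.MonoidalLeftAction
open scoped CategoryTheory.Obj CategoryTheory.Prod

/-! ### Right exact linear and right exact bilinear functors -/

section RightExact

universe w v₁ v₂ v₃ v₄ u₁ u₂ u₃ u₄

variable (k : Type w) [Field k]

/-- A right exact `k`-linear functor. -/
structure IsRightExactLinear {T : Type u₃} [Category.{v₃} T] [Preadditive T] [Linear k T]
    {X : Type u₄} [Category.{v₄} X] [Preadditive X] [Linear k X] (G : T ⥤ X) : Prop where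
  additive : G.Additive
  linear : G.Linear k
  rightExact : PreservesFiniteColimits G

/-- A right exact `k`-bilinear functor: `k`-linear and right exact in each variable. -/
structure IsRightExactBilinear {M : Type u₁} [Category.{v₁} M] [Preadditive M] [Linear k M]
    {N : Type u₂} [Category.{v₂} N] [Preadditive N] [Linear k N]
    {X : Type u₄} [Category.{v₄} X] [Preadditive X] [Linear k X] (G : M × N ⥤ X) : Prop where
  left (n : N) : IsRightExactLinear k (Prod.sectL M n ⋙ G)
  right (m : M) : IsRightExactLinear k (Prod.sectR m N ⋙ G)

theorem IsRightExactLinear.comp {S : Type u₁} [Category.{v₁} S] [Preadditive S] [Linear k S]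
    {T : Type u₃} [Category.{v₃} T] [Preadditive T] [Linear k T]
    {X : Type u₄} [Category.{v₄} X] [Preadditive X] [Linear k X] {G : S ⥤ T} {H : T ⥤ X}
    (hG : IsRightExactLinear k G) (hH : IsRightExactLinear k H) :
    IsRightExactLinear k (G ⋙ H) := by
  obtain ⟨_, _, _⟩ := hG
  obtain ⟨_, _, _⟩ := hH
  exact ⟨inferInstance, inferInstance, comp_preservesFiniteColimits G H⟩

theorem IsRightExactBilinear.comp
    {M : Type u₁} [Category.{v₁} M] [Preadditive M] [Linear k M]
    {N : Type u₂} [Category.{v₂} N] [Preadditive N] [Linear k N]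
    {T : Type u₃} [Category.{v₃} T] [Preadditive T] [Linear k T]
    {X : Type u₄} [Category.{v₄} X] [Preadditive X] [Linear k X]
    {P : M × N ⥤ T} {H : T ⥤ X}
    (hP : IsRightExactBilinear k P) (hH : IsRightExactLinear k H) :
    IsRightExactBilinear k (P ⋙ H) :=
  ⟨fun n => (hP.left n).comp k hH, fun m => (hP.right m).comp k hH⟩

/-- The category of right exact linear functors `T ⥤ X` (and all natural transformations). -/
abbrev RightExactLinearFunctor (T : Type u₃) [Category.{v₃} T] [Preadditive T] [Linear k T]
    (X : Type u₄) [Category.{v₄} X] [Preadditive X] [Linear k X] :=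
  ObjectProperty.FullSubcategory (fun G : T ⥤ X => IsRightExactLinear k G)

/-- The category of right exact bilinear functors `M × N ⥤ X` (and all natural
transformations). -/
abbrev RightExactBilinearFunctor (M : Type u₁) [Category.{v₁} M] [Preadditive M] [Linear k M]
    (N : Type u₂) [Category.{v₂} N] [Preadditive N] [Linear k N]
    (X : Type u₄) [Category.{v₄} X] [Preadditive X] [Linear k X] :=
  ObjectProperty.FullSubcategory (fun G : M × N ⥤ X => IsRightExactBilinear k G)

variable {M : Type u₁} [Category.{v₁} M] [Preadditive M] [Linear k M]
    {N : Type u₂} [Category.{v₂} N] [Preadditive N] [Linear k N]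
    {T : Type u₃} [Category.{v₃} T] [Preadditive T] [Linear k T]

/-- Restriction of right exact linear functors on `T` along a right exact bilinear functor
`P : M × N ⥤ T`. -/
def restrictAlong {P : M × N ⥤ T} (hP : IsRightExactBilinear k P)
    (X : Type u₄) [Category.{v₄} X] [Preadditive X] [Linear k X] :
    RightExactLinearFunctor k T X ⥤ RightExactBilinearFunctor k M N X :=
  ObjectProperty.lift _
    (ObjectProperty.ι _ ⋙ (Functor.whiskeringLeft (M × N) T X).obj P)
    (fun H => hP.comp k H.property)

end RightExact

section Deligne

universe w v₁ v₂ v₃ u₁ u₂ u₃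

/-- The `k`-linear abelian category `T` together with `P : M × N ⥤ T` is a Deligne tensor product
of the `k`-linear categories `M` and `N`: the functor `P` is right exact bilinear, and for every
`k`-linear abelian category `X`, restriction along `P` is an equivalence from the category of right
exact linear functors `T ⥤ X` to the category of right exact bilinear functors `M × N ⥤ X`. -/
structure IsDeligneProduct (k : Type w) [Field k]
    {M : Type u₁} [Category.{v₁} M] [Preadditive M] [Linear k M]
    {N : Type u₂} [Category.{v₂} N] [Preadditive N] [Linear k N]
    {T : Type u₃} [Category.{v₃} T] [Abelian T] [Linear k T] (P : M × N ⥤ T) : Prop where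
  bilinear : IsRightExactBilinear k P
  universal (X : Type u₃) [Category.{v₃} X] [Abelian X] [Linear k X] :
    (restrictAlong k bilinear X).IsEquivalence

end Deligne

/-! ### Right modules over an algebra object -/

section RightModules

universe w v u

variable {C : Type u} [Category.{v} C] [MonoidalCategory C]

/-- A right module object in `C` over an algebra (monoid) object `B` of `C`. -/
structure RightMod (B : C) [MonObj B] where
  /-- the underlying object -/
  X : C
  /-- the right action of `B` -/
  act : X ⊗ B ⟶ X
  act_one : X ◁ η[B] ≫ act = (ρ_ X).hom
  act_mul : X ◁ μ[B] ≫ act = (α_ X B B).inv ≫ act ▷ B ≫ act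

namespace RightMod

variable {B : C} [MonObj B]

/-- Morphisms of right modules: morphisms commuting with the actions. -/
@[ext]
structure Hom (M N : RightMod B) where
  /-- the underlying morphism -/
  hom : M.X ⟶ N.X
  act_hom : M.act ≫ hom = hom ▷ B ≫ N.act

instance : Category (RightMod B) where
  Hom M N := Hom M N
  id M := ⟨𝟙 M.X, by simp⟩
  comp f g := ⟨f.hom ≫ g.hom, by
    rw [← Category.assoc, f.act_hom, Category.assoc, g.act_hom, comp_whiskerRight,
      Category.assoc]⟩

@[ext]
theorem hom_ext {M N : RightMod B} {f g : M ⟶ N} (h : Hom.hom f = Hom.hom g) : f = g :=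
  Hom.ext h

@[simp] theorem id_hom (M : RightMod B) : Hom.hom (𝟙 M) = 𝟙 M.X := rfl

@[simp] theorem comp_hom {M N K : RightMod B} (f : M ⟶ N) (g : N ⟶ K) :
    Hom.hom (f ≫ g) = Hom.hom f ≫ Hom.hom g := rfl

/-- Constructor for isomorphisms of right modules. -/
@[simps]
def isoMk {M N : RightMod B} (e : M.X ≅ N.X) (h : M.act ≫ e.hom = e.hom ▷ B ≫ N.act) :
    M ≅ N where
  hom := ⟨e.hom, h⟩
  inv := ⟨e.inv, by
    rw [Iso.comp_inv_eq, Category.assoc, h, ← Category.assoc, ← comp_whiskerRight]; simp⟩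
  hom_inv_id := by ext; exact e.hom_inv_id
  inv_hom_id := by ext; exact e.inv_hom_id

theorem hom_injective (M N : RightMod B) :
    Function.Injective (fun f : M ⟶ N => Hom.hom f) := fun _ _ h => hom_ext h

/-! #### The `k`-linear structure on the category of right modules -/

section Linear

variable [Preadditive C] [MonoidalPreadditive C]

instance (M N : RightMod B) : Zero (M ⟶ N) := ⟨⟨0, by simp⟩⟩
instance (M N : RightMod B) : Add (M ⟶ N) :=
  ⟨fun f g => ⟨Hom.hom f + Hom.hom g, by simp [f.act_hom, g.act_hom]⟩⟩
instance (M N : RightMod B) : Neg (M ⟶ N) :=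
  ⟨fun f => ⟨-Hom.hom f, by
    have h : (-Hom.hom f) ▷ B = -(Hom.hom f ▷ B) := (tensorRight B).map_neg
    rw [h]; simp [f.act_hom]⟩⟩
instance (M N : RightMod B) : Sub (M ⟶ N) :=
  ⟨fun f g => ⟨Hom.hom f - Hom.hom g, by
    have h : (Hom.hom f - Hom.hom g) ▷ B = Hom.hom f ▷ B - Hom.hom g ▷ B :=
      (tensorRight B).map_sub
    rw [h]; simp [f.act_hom, g.act_hom]⟩⟩
instance (M N : RightMod B) : SMul ℕ (M ⟶ N) :=
  ⟨fun n f => ⟨n • Hom.hom f, by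
    have h : (n • Hom.hom f) ▷ B = n • (Hom.hom f ▷ B) := (tensorRight B).map_nsmul
    rw [h]; simp [f.act_hom]⟩⟩
instance (M N : RightMod B) : SMul ℤ (M ⟶ N) :=
  ⟨fun n f => ⟨n • Hom.hom f, by
    have h : (n • Hom.hom f) ▷ B = n • (Hom.hom f ▷ B) := (tensorRight B).map_zsmul
    rw [h]; simp [f.act_hom]⟩⟩

instance (M N : RightMod B) : AddCommGroup (M ⟶ N) :=
  (hom_injective M N).addCommGroup _ rfl (fun _ _ => rfl) (fun _ => rfl) (fun _ _ => rfl)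
    (fun _ _ => rfl) (fun _ _ => rfl)

@[simp] theorem add_hom {M N : RightMod B} (f g : M ⟶ N) :
    Hom.hom (f + g) = Hom.hom f + Hom.hom g := rfl

instance : Preadditive (RightMod B) where
  add_comp _ _ _ f f' g := by ext; simp
  comp_add _ _ _ f g g' := by ext; simp

variable {k : Type w} [Field k] [Linear k C] [MonoidalLinear k C]

instance (M N : RightMod B) : SMul k (M ⟶ N) :=
  ⟨fun r f => ⟨r • Hom.hom f, by simp [f.act_hom]⟩⟩

@[simp] theorem smul_hom {M N : RightMod B} (r : k) (f : M ⟶ N) :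
    Hom.hom (r • f) = r • Hom.hom f := rfl

instance (M N : RightMod B) : Module k (M ⟶ N) :=
  (hom_injective M N).module k ⟨⟨fun f => Hom.hom f, rfl⟩, fun _ _ => rfl⟩ (fun _ _ => rfl)

instance : Linear k (RightMod B) where
  smul_comp _ _ _ r f g := by ext; simp
  comp_smul _ _ _ f r g := by ext; simp

end Linear

/-! #### The left action of `C` on the category of right modules -/

/-- For an object `c` and a right module `M`, the object `c ⊗ M` with `B` acting on `M`. -/
@[simps]
def tensorMod (c : C) (M : RightMod B) : RightMod B where
  X := c ⊗ M.X
  act := (α_ c M.X B).hom ≫ c ◁ M.act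
  act_one := by
    rw [associator_naturality_right_assoc, ← whiskerLeft_comp, M.act_one]
    simp
  act_mul := by
    rw [associator_naturality_right_assoc, ← whiskerLeft_comp, M.act_mul]
    simp

/-- The left action of `C` on right modules; all coherence identities are those of `C`. -/
instance : MonoidalLeftAction C (RightMod B) where
  actionObj c M := tensorMod c M
  actionHomLeft {c c'} f M := ⟨f ▷ M.X, by
    change ((α_ c M.X B).hom ≫ c ◁ M.act) ≫ f ▷ M.X =
      (f ▷ M.X) ▷ B ≫ (α_ c' M.X B).hom ≫ c' ◁ M.act
    rw [Category.assoc, whisker_exchange, associator_naturality_left_assoc]⟩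
  actionHomRight c {M N} g := ⟨c ◁ Hom.hom g, by
    change ((α_ c M.X B).hom ≫ c ◁ M.act) ≫ c ◁ Hom.hom g =
      (c ◁ Hom.hom g) ▷ B ≫ (α_ c N.X B).hom ≫ c ◁ N.act
    rw [Category.assoc, ← whiskerLeft_comp, g.act_hom, whiskerLeft_comp,
      associator_naturality_middle_assoc]⟩
  actionHom {c c' M N} f g := ⟨f ⊗ₘ Hom.hom g, by
    change ((α_ c M.X B).hom ≫ c ◁ M.act) ≫ (f ⊗ₘ Hom.hom g) =
      (f ⊗ₘ Hom.hom g) ▷ B ≫ (α_ c' N.X B).hom ≫ c' ◁ N.act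
    rw [MonoidalCategory.tensorHom_def, comp_whiskerRight, Category.assoc, Category.assoc,
      associator_naturality_middle_assoc, ← whiskerLeft_comp, ← g.act_hom,
      associator_naturality_left_assoc, whisker_exchange_assoc, whiskerLeft_comp]⟩
  actionAssocIso c c' M := isoMk (α_ c c' M.X) (by
    change ((α_ (c ⊗ c') M.X B).hom ≫ (c ⊗ c') ◁ M.act) ≫ (α_ c c' M.X).hom =
      (α_ c c' M.X).hom ▷ B ≫ (α_ c (c' ⊗ M.X) B).hom ≫ c ◁ ((α_ c' M.X B).hom ≫ c' ◁ M.act)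
    simp)
  actionUnitIso M := isoMk (λ_ M.X) (by
    change ((α_ (𝟙_ C) M.X B).hom ≫ (𝟙_ C) ◁ M.act) ≫ (λ_ M.X).hom =
      (λ_ M.X).hom ▷ B ≫ M.act
    simp)
  actionHom_def f g := hom_ext (MonoidalLeftAction.actionHom_def f (Hom.hom g))
  actionHomRight_id c M := hom_ext (MonoidalLeftAction.actionHomRight_id c M.X)
  id_actionHomLeft c M := hom_ext (MonoidalLeftAction.id_actionHomLeft c M.X)
  actionHom_comp f₁ f₂ g₁ g₂ :=
    hom_ext (MonoidalLeftAction.actionHom_comp f₁ f₂ (Hom.hom g₁) (Hom.hom g₂))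
  actionAssocIso_hom_naturality f g h :=
    hom_ext (MonoidalLeftAction.actionAssocIso_hom_naturality f g (Hom.hom h))
  actionUnitIso_hom_naturality f :=
    hom_ext (MonoidalLeftAction.actionUnitIso_hom_naturality (C := C) (Hom.hom f))
  whiskerLeft_actionHomLeft c _ _ f M :=
    hom_ext (MonoidalLeftAction.whiskerLeft_actionHomLeft c f M.X)
  whiskerRight_actionHomLeft c f M :=
    hom_ext (MonoidalLeftAction.whiskerRight_actionHomLeft c f M.X)
  associator_actionHom c₁ c₂ c₃ M :=
    hom_ext (MonoidalLeftAction.associator_actionHom c₁ c₂ c₃ M.X)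
  leftUnitor_actionHom c M := hom_ext (MonoidalLeftAction.leftUnitor_actionHom c M.X)
  rightUnitor_actionHom c M := hom_ext (MonoidalLeftAction.rightUnitor_actionHom c M.X)

end RightMod

end RightModules

/-! ### Algebra objects and actions on Deligne products -/

section Induced

universe w v₁ v₂ v₃ v₄ v₅ v₆ u₁ u₂ u₃ u₄ u₅ u₆

/-- A pair of algebra objects is an algebra object in the product category, with componentwise
unit and multiplication. For a monoidal functor `F : C × D ⥤ E`, the object `F.obj (A, B)` (that is,
`A ⊠ B`) becomes an algebra object of `E` through the lax monoidal structure of `F`. -/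
instance prodMonObj {C : Type u₁} [Category.{v₁} C] [MonoidalCategory C]
    {D : Type u₂} [Category.{v₂} D] [MonoidalCategory D]
    (A : C) [MonObj A] (B : D) [MonObj B] : MonObj ((A, B) : C × D) where
  one := η[A] ×ₘ η[B]
  mul := μ[A] ×ₘ μ[B]
  one_mul := by ext <;> simp
  mul_one := by ext <;> simp
  mul_assoc := by ext <;> simp

/-- Let `F : C × D ⥤ E` be a monoidal functor (written `c ⊠ d`), let `C` act on `M` and `D` act on
`N`, and let `P : M × N ⥤ Q` be a functor (written `m ⊠ n`). This structure says that a given left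
action of `E` on `Q` is induced by the actions of `C` on `M` and of `D` on `N`: it is right exact
bilinear, and there are coherent natural isomorphisms `(c ⊠ d) ⊙ (m ⊠ n) ≅ (c ⊙ m) ⊠ (d ⊙ n)`. -/
structure InducedAction (k : Type w) [Field k]
    {C : Type u₁} [Category.{v₁} C] [MonoidalCategory C]
    {D : Type u₂} [Category.{v₂} D] [MonoidalCategory D]
    {E : Type u₃} [Category.{v₃} E] [MonoidalCategory E] [Preadditive E] [Linear k E]
    {M : Type u₄} [Category.{v₄} M] [MonoidalLeftAction C M]
    {N : Type u₅} [Category.{v₅} N] [MonoidalLeftAction D N]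
    {Q : Type u₆} [Category.{v₆} Q] [Preadditive Q] [Linear k Q] [MonoidalLeftAction E Q]
    (F : C × D ⥤ E) [F.Monoidal] (P : M × N ⥤ Q) where
  bilinear : IsRightExactBilinear k (Functor.uncurry.obj (MonoidalLeftAction.curriedAction E Q))
  /-- the comparison `(c ⊠ d) ⊙ (m ⊠ n) ≅ (c ⊙ m) ⊠ (d ⊙ n)` -/
  iso (c : C) (d : D) (m : M) (n : N) :
    F.obj (c, d) ⊙ₗ P.obj (m, n) ≅ P.obj (c ⊙ₗ m, d ⊙ₗ n)
  naturality {c c' : C} {d d' : D} {m m' : M} {n n' : N}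
    (f : c ⟶ c') (g : d ⟶ d') (a : m ⟶ m') (b : n ⟶ n') :
    (F.map (f ×ₘ g) ⊙ₗₘ P.map (a ×ₘ b)) ≫ (iso c' d' m' n').hom =
      (iso c d m n).hom ≫ P.map ((f ⊙ₗₘ a) ×ₘ (g ⊙ₗₘ b))
  associativity (c c' : C) (d d' : D) (m : M) (n : N) :
    Functor.LaxMonoidal.μ F (c, d) (c', d') ⊵ₗ P.obj (m, n) ≫ (iso (c ⊗ c') (d ⊗ d') m n).hom ≫
        P.map ((αₗ c c' m).hom ×ₘ (αₗ d d' n).hom) =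
      (αₗ (F.obj (c, d)) (F.obj (c', d')) (P.obj (m, n))).hom ≫
        F.obj (c, d) ⊴ₗ (iso c' d' m n).hom ≫ (iso c d (c' ⊙ₗ m) (d' ⊙ₗ n)).hom
  unitality (m : M) (n : N) :
    Functor.LaxMonoidal.ε F ⊵ₗ P.obj (m, n) ≫ (iso (𝟙_ C) (𝟙_ D) m n).hom ≫
        P.map ((λₗ m).hom ×ₘ (λₗ n).hom) =
      (λₗ (P.obj (m, n))).hom

end Induced

universe w u v

/-! ### Right exact linear functors and Deligne products -/

section

universe v₁ v₂ v₃ v₄ u₁ u₂ u₃ u₄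

variable {k : Type w} [Field k]

namespace IsRightExactLinear

variable {T : Type u₃} [Category.{v₃} T] [Preadditive T] [Linear k T]
    {X : Type u₄} [Category.{v₄} X] [Preadditive X] [Linear k X]

theorem of_iso {G H : T ⥤ X} (e : G ≅ H) (hG : IsRightExactLinear k G) :
    IsRightExactLinear k H := by
  obtain ⟨_, _, _⟩ := hG
  exact ⟨Functor.additive_of_iso e, Functor.linear_of_iso k e,
    preservesFiniteColimits_of_natIso e⟩

end IsRightExactLinear

/-- Precomposition of a right exact bilinear functor with right exact linear functors in both
variables. -/
theorem IsRightExactBilinear.prod_comp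
    {M : Type u₁} [Category.{v₁} M] [Preadditive M] [Linear k M]
    {N : Type u₂} [Category.{v₂} N] [Preadditive N] [Linear k N]
    {M' : Type u₃} [Category.{v₃} M'] [Preadditive M'] [Linear k M']
    {N' : Type u} [Category.{v} N'] [Preadditive N'] [Linear k N']
    {X : Type u₄} [Category.{v₄} X] [Preadditive X] [Linear k X]
    {R : M' ⥤ M} {S : N' ⥤ N} {G : M × N ⥤ X} (hR : IsRightExactLinear k R)
    (hS : IsRightExactLinear k S) (hG : IsRightExactBilinear k G) :
    IsRightExactBilinear k (R.prod S ⋙ G) :=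
  ⟨fun n =>
      let e : R ⋙ Prod.sectL M (S.obj n) ⋙ G ≅ Prod.sectL M' n ⋙ R.prod S ⋙ G :=
        NatIso.ofComponents (fun _ => Iso.refl _) (fun f => (Category.comp_id _).trans (Eq.trans
          (congrArg (fun g => G.map (R.map f ×ₘ g)) (S.map_id n).symm)
          (Category.id_comp _).symm))
      (hR.comp k (hG.left (S.obj n))).of_iso e,
    fun m =>
      let e : S ⋙ Prod.sectR (R.obj m) N ⋙ G ≅ Prod.sectR m N' ⋙ R.prod S ⋙ G :=
        NatIso.ofComponents (fun _ => Iso.refl _) (fun f => (Category.comp_id _).trans (Eq.trans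
          (congrArg (fun g => G.map (g ×ₘ S.map f)) (R.map_id m).symm)
          (Category.id_comp _).symm))
      (hS.comp k (hG.right (R.obj m))).of_iso e⟩

namespace IsDeligneProduct

variable {M : Type u₁} [Category.{v₁} M] [Preadditive M] [Linear k M]
    {N : Type u₂} [Category.{v₂} N] [Preadditive N] [Linear k N]
    {T : Type u₃} [Category.{v₃} T] [Abelian T] [Linear k T] {P : M × N ⥤ T}

section

variable {X : Type u₃} [Category.{v₃} X] [Abelian X] [Linear k X] {H H' : T ⥤ X}

theorem natTrans_ext (hP : IsDeligneProduct k P) (hH : IsRightExactLinear k H)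
    (hH' : IsRightExactLinear k H') (α β : H ⟶ H')
    (h : ∀ x, α.app (P.obj x) = β.app (P.obj x)) : α = β := by
  have := hP.universal X
  have key : (ObjectProperty.homMk α : (⟨H, hH⟩ : RightExactLinearFunctor k T X) ⟶ ⟨H', hH'⟩) =
      ObjectProperty.homMk β := by
    apply (restrictAlong k hP.bilinear X).map_injective
    ext x
    exact h x
  exact congrArg (fun f => f.hom) key

theorem exists_natTrans (hP : IsDeligneProduct k P) (hH : IsRightExactLinear k H)
    (hH' : IsRightExactLinear k H') (t : P ⋙ H ⟶ P ⋙ H') :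
    ∃ α : H ⟶ H', ∀ x, α.app (P.obj x) = t.app x := by
  have := hP.universal X
  let t' : (restrictAlong k hP.bilinear X).obj ⟨H, hH⟩ ⟶
      (restrictAlong k hP.bilinear X).obj ⟨H', hH'⟩ := ObjectProperty.homMk t
  obtain ⟨α, hα⟩ := (restrictAlong k hP.bilinear X).map_surjective t'
  refine ⟨α.hom, fun x => ?_⟩
  exact congrArg (fun f => f.hom.app x) hα

theorem exists_natIso (hP : IsDeligneProduct k P) (hH : IsRightExactLinear k H)
    (hH' : IsRightExactLinear k H') (t : P ⋙ H ≅ P ⋙ H') :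
    ∃ α : H ≅ H', ∀ x, α.hom.app (P.obj x) = t.hom.app x := by
  obtain ⟨α, hα⟩ := hP.exists_natTrans hH hH' t.hom
  obtain ⟨β, hβ⟩ := hP.exists_natTrans hH' hH t.inv
  refine ⟨⟨α, β, hP.natTrans_ext hH hH _ _ fun x => ?_,
    hP.natTrans_ext hH' hH' _ _ fun x => ?_⟩, hα⟩
  · rw [NatTrans.comp_app, hα, hβ, Iso.hom_inv_id_app]; rfl
  · rw [NatTrans.comp_app, hα, hβ, Iso.inv_hom_id_app]; rfl

theorem exists_extension (hP : IsDeligneProduct k P) {G : M × N ⥤ X}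
    (hG : IsRightExactBilinear k G) :
    ∃ H : T ⥤ X, IsRightExactLinear k H ∧ Nonempty (P ⋙ H ≅ G) := by
  have := hP.universal X
  let e := (restrictAlong k hP.bilinear X).objObjPreimageIso ⟨G, hG⟩
  exact ⟨_, ((restrictAlong k hP.bilinear X).objPreimage ⟨G, hG⟩).property,
    ⟨(ObjectProperty.ι _).mapIso e⟩⟩

end

/-- The universal property of a Deligne product, checked on functors and natural
transformations. -/
theorem mk' (hP : IsRightExactBilinear k P)
    (ext : ∀ (X : Type u₃) [Category.{v₃} X] [Abelian X] [Linear k X] {H H' : T ⥤ X},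
      IsRightExactLinear k H → IsRightExactLinear k H' → ∀ α β : H ⟶ H',
      (∀ x, α.app (P.obj x) = β.app (P.obj x)) → α = β)
    (lift : ∀ (X : Type u₃) [Category.{v₃} X] [Abelian X] [Linear k X] {H H' : T ⥤ X},
      IsRightExactLinear k H → IsRightExactLinear k H' → ∀ t : P ⋙ H ⟶ P ⋙ H',
      ∃ α : H ⟶ H', ∀ x, α.app (P.obj x) = t.app x)
    (extend : ∀ (X : Type u₃) [Category.{v₃} X] [Abelian X] [Linear k X] {G : M × N ⥤ X},
      IsRightExactBilinear k G →
      ∃ H : T ⥤ X, IsRightExactLinear k H ∧ Nonempty (P ⋙ H ≅ G)) :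
    IsDeligneProduct k P where
  bilinear := hP
  universal X _ _ _ :=
    { faithful := ⟨fun {H H'} α β h => by
        ext : 1
        exact ext X H.property H'.property _ _ fun x => congrArg (fun f => f.hom.app x) h⟩
      full := ⟨fun {H H'} t => by
        obtain ⟨α, hα⟩ := lift X H.property H'.property t.hom
        refine ⟨ObjectProperty.homMk α, ?_⟩
        ext x
        exact hα x⟩
      essSurj := ⟨fun G => by
        obtain ⟨H, hH, ⟨e⟩⟩ := extend X G.property
        exact ⟨⟨H, hH⟩, ⟨ObjectProperty.isoMk _ e⟩⟩⟩ }

/-- Two Deligne products are equivalent, compatibly with the universal bilinear functors. -/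
theorem exists_equivalence (hP : IsDeligneProduct k P)
    {T' : Type u₃} [Category.{v₃} T'] [Abelian T'] [Linear k T'] {P' : M × N ⥤ T'}
    (hP' : IsDeligneProduct k P') :
    ∃ e : T ≌ T', IsRightExactLinear k e.functor ∧ Nonempty (P ⋙ e.functor ≅ P') := by
  obtain ⟨H, hH, ⟨i⟩⟩ := hP.exists_extension hP'.bilinear
  obtain ⟨H', hH', ⟨i'⟩⟩ := hP'.exists_extension hP.bilinear
  have id_linear {S : Type u₃} [Category.{v₃} S] [Abelian S] [Linear k S] :
      IsRightExactLinear k (𝟭 S) := ⟨inferInstance, inferInstance, inferInstance⟩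
  obtain ⟨a, -⟩ := hP.exists_natIso (hH.comp k hH') id_linear
    ((Functor.associator _ _ _).symm ≪≫ Functor.isoWhiskerRight i H' ≪≫ i' ≪≫
      (Functor.rightUnitor _).symm)
  obtain ⟨b, -⟩ := hP'.exists_natIso (hH'.comp k hH) id_linear
    ((Functor.associator _ _ _).symm ≪≫ Functor.isoWhiskerRight i' H ≪≫ i ≪≫
      (Functor.rightUnitor _).symm)
  exact ⟨CategoryTheory.Equivalence.mk H H' a.symm b, hH, ⟨i⟩⟩

end IsDeligneProduct

section TwoVariables

theorem map_prod_exchange {E : Type u} [Category.{v} E] {Q : Type u₁} [Category.{v₁} Q]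
    {X : Type u₂} [Category.{v₂} X] (K : E × Q ⥤ X) {e e' : E} {q q' : Q} (f : e ⟶ e')
    (g : q ⟶ q') :
    K.map (f ×ₘ 𝟙 q) ≫ K.map (𝟙 e' ×ₘ g) = K.map (𝟙 e ×ₘ g) ≫ K.map (f ×ₘ 𝟙 q') := by
  rw [← K.map_comp, ← K.map_comp]
  congr 1
  ext <;> simp

variable {M₁ : Type u₁} [Category.{v₁} M₁] [Preadditive M₁] [Linear k M₁]
    {N₁ : Type u₂} [Category.{v₂} N₁] [Preadditive N₁] [Linear k N₁]
    {M₂ : Type u₃} [Category.{v₃} M₂] [Preadditive M₂] [Linear k M₂]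
    {N₂ : Type u₄} [Category.{v₄} N₂] [Preadditive N₂] [Linear k N₂]
    {E : Type u} [Category.{v} E] [Abelian E] [Linear k E] {F : M₁ × N₁ ⥤ E}
    {Q : Type u} [Category.{v} Q] [Abelian Q] [Linear k Q] {P : M₂ × N₂ ⥤ Q}
    {X : Type u} [Category.{v} X] [Abelian X] [Linear k X] {K K' : E × Q ⥤ X}

theorem IsDeligneProduct.natTrans_ext₂ (hF : IsDeligneProduct k F) (hP : IsDeligneProduct k P)
    (hK : IsRightExactBilinear k K) (hK' : IsRightExactBilinear k K') (α β : K ⟶ K')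
    (h : ∀ x y, α.app (F.obj x, P.obj y) = β.app (F.obj x, P.obj y)) : α = β := by
  have h1 (y) : Functor.whiskerLeft (Prod.sectL E (P.obj y)) α = Functor.whiskerLeft _ β :=
    hF.natTrans_ext (hK.left _) (hK'.left _) _ _ fun x => h x y
  have h2 (e) : Functor.whiskerLeft (Prod.sectR e Q) α = Functor.whiskerLeft _ β :=
    hP.natTrans_ext (hK.right _) (hK'.right _) _ _ fun y => NatTrans.congr_app (h1 y) e
  ext ⟨e, q⟩
  exact NatTrans.congr_app (h2 e) q

theorem IsDeligneProduct.exists_natTrans₂ (hF : IsDeligneProduct k F)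
    (hP : IsDeligneProduct k P)
    (hK : IsRightExactBilinear k K) (hK' : IsRightExactBilinear k K')
    (t : F.prod P ⋙ K ⟶ F.prod P ⋙ K') :
    ∃ α : K ⟶ K', ∀ x y, α.app (F.obj x, P.obj y) = t.app (x, y) := by
  have ht {x x' y y'} (f : x ⟶ x') (g : y ⟶ y') :
      K.map (F.map f ×ₘ P.map g) ≫ t.app (x', y') =
        t.app (x, y) ≫ K'.map (F.map f ×ₘ P.map g) := t.naturality (f ×ₘ g)
  have h1 (y) := hF.exists_natTrans (hK.left (P.obj y)) (hK'.left (P.obj y))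
    { app x := t.app (x, y)
      naturality x x' f := by
        have := ht f (𝟙 y)
        rw [P.map_id] at this
        exact this }
  choose A hA using h1
  have h2 (e) := hP.exists_natTrans (hK.right e) (hK'.right e)
    { app y := (A y).app e
      naturality y y' g := by
        let l : Prod.sectL E (P.obj y) ⋙ K ⟶ Prod.sectL E (P.obj y') ⋙ K :=
          { app e := K.map (𝟙 e ×ₘ P.map g)
            naturality _ _ f := map_prod_exchange K f (P.map g) }
        let r : Prod.sectL E (P.obj y) ⋙ K' ⟶ Prod.sectL E (P.obj y') ⋙ K' :=
          { app e := K'.map (𝟙 e ×ₘ P.map g)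
            naturality _ _ f := map_prod_exchange K' f (P.map g) }
        have : l ≫ A y' = A y ≫ r :=
          hF.natTrans_ext (hK.left _) (hK'.left _) _ _ fun x => by
            rw [NatTrans.comp_app, NatTrans.comp_app, hA, hA]
            have := ht (𝟙 x) g
            rw [F.map_id] at this
            exact this
        exact NatTrans.congr_app this e }
  choose D hD using h2
  obtain ⟨d, hd⟩ : ∃ d : ∀ e q, K.obj (e, q) ⟶ K'.obj (e, q), ∀ e q, d e q = (D e).app q :=
    ⟨fun e q => (D e).app q, fun _ _ => rfl⟩
  have nat {e e'} (f : e ⟶ e') (q) :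
      K.map (f ×ₘ 𝟙 q) ≫ d e' q = d e q ≫ K'.map (f ×ₘ 𝟙 q) := by
    rw [hd, hd]
    let l : Prod.sectR e Q ⋙ K ⟶ Prod.sectR e' Q ⋙ K :=
      { app q := K.map (f ×ₘ 𝟙 q)
        naturality _ _ g := (map_prod_exchange K f g).symm }
    let r : Prod.sectR e Q ⋙ K' ⟶ Prod.sectR e' Q ⋙ K' :=
      { app q := K'.map (f ×ₘ 𝟙 q)
        naturality _ _ g := (map_prod_exchange K' f g).symm }
    have : l ≫ D e' = D e ≫ r :=
      hP.natTrans_ext (hK.right _) (hK'.right _) _ _ fun y => by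
        rw [NatTrans.comp_app, NatTrans.comp_app, hD, hD]
        exact (A y).naturality f
    exact NatTrans.congr_app this q
  have nat' (e) {q q'} (g : q ⟶ q') :
      K.map (𝟙 e ×ₘ g) ≫ d e q' = d e q ≫ K'.map (𝟙 e ×ₘ g) := by
    rw [hd, hd]
    exact (D e).naturality g
  have map_eq (L : E × Q ⥤ X) {e e' q q'} (f : e ⟶ e') (g : q ⟶ q') :
      L.map (f ×ₘ g) = L.map (f ×ₘ 𝟙 q) ≫ L.map (𝟙 e' ×ₘ g) := by
    rw [← L.map_comp]
    simp
  have nat₂ {e e' q q'} (f : e ⟶ e') (g : q ⟶ q') :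
      K.map (f ×ₘ g) ≫ d e' q' = d e q ≫ K'.map (f ×ₘ g) := by
    rw [map_eq K, map_eq K', Category.assoc, nat', reassoc_of% nat f q]
  exact ⟨{ app z := d z.1 z.2, naturality z z' f := nat₂ f.1 f.2 }, fun x y =>
    (hd _ _).trans ((hD _ _).trans (hA _ _))⟩

theorem IsDeligneProduct.exists_natIso₂ (hF : IsDeligneProduct k F)
    (hP : IsDeligneProduct k P)
    (hK : IsRightExactBilinear k K) (hK' : IsRightExactBilinear k K')
    (t : F.prod P ⋙ K ≅ F.prod P ⋙ K') :
    ∃ α : K ≅ K', ∀ x y, α.hom.app (F.obj x, P.obj y) = t.hom.app (x, y) := by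
  obtain ⟨α, hα⟩ := hF.exists_natTrans₂ hP hK hK' t.hom
  obtain ⟨β, hβ⟩ := hF.exists_natTrans₂ hP hK' hK t.inv
  refine ⟨⟨α, β, hF.natTrans_ext₂ hP hK hK _ _ fun x y => ?_,
    hF.natTrans_ext₂ hP hK' hK' _ _ fun x y => ?_⟩, hα⟩
  · rw [NatTrans.comp_app, hα, hβ, Iso.hom_inv_id_app]; rfl
  · rw [NatTrans.comp_app, hα, hβ, Iso.inv_hom_id_app]; rfl

end TwoVariables

end

/-! ### Functors out of a Deligne product are functors of module categories -/

section

universe v₁ v₂ v₃ v₄ u₁ u₂ u₃ u₄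

variable {k : Type w} [Field k]

section

variable {M : Type u₁} [Category.{v₁} M] [Preadditive M] [Linear k M]
    {N : Type u₂} [Category.{v₂} N] [Preadditive N] [Linear k N]
    {X : Type u₄} [Category.{v₄} X] [Preadditive X] [Linear k X]

theorem IsRightExactBilinear.obj {K : M ⥤ N ⥤ X}
    (h : IsRightExactBilinear k (Functor.uncurry.obj K)) (m : M) :
    IsRightExactLinear k (K.obj m) :=
  let e : Prod.sectR m N ⋙ Functor.uncurry.obj K ≅ K.obj m :=
    NatIso.ofComponents (fun _ => Iso.refl _) (fun f => (Category.comp_id _).trans (Eq.trans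
      (show (K.map (𝟙 m)).app _ ≫ (K.obj m).map f = (K.obj m).map f by simp)
      (Category.id_comp _).symm))
  (h.right m).of_iso e

theorem IsRightExactBilinear.flip_obj {K : M ⥤ N ⥤ X}
    (h : IsRightExactBilinear k (Functor.uncurry.obj K)) (n : N) :
    IsRightExactLinear k (K.flip.obj n) :=
  let e : Prod.sectL M n ⋙ Functor.uncurry.obj K ≅ K.flip.obj n :=
    NatIso.ofComponents (fun _ => Iso.refl _) (fun {_ m} f => (Category.comp_id _).trans (Eq.trans
      (show (K.map f).app _ ≫ (K.obj m).map (𝟙 n) = (K.map f).app n by simp)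
      (Category.id_comp _).symm))
  (h.left n).of_iso e

theorem IsRightExactBilinear.of_obj {K : M ⥤ N ⥤ X}
    (h : ∀ m, IsRightExactLinear k (K.obj m)) (h' : ∀ n, IsRightExactLinear k (K.flip.obj n)) :
    IsRightExactBilinear k (Functor.uncurry.obj K) :=
  ⟨fun n =>
    let e : K.flip.obj n ≅ Prod.sectL M n ⋙ Functor.uncurry.obj K :=
      NatIso.ofComponents (fun _ => Iso.refl _) (fun {_ m} f => (Category.comp_id _).trans
        (Eq.trans (show (K.map f).app n = (K.map f).app _ ≫ (K.obj m).map (𝟙 n) by simp)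
          (Category.id_comp _).symm))
    (h' n).of_iso e,
  fun m =>
    let e : K.obj m ≅ Prod.sectR m N ⋙ Functor.uncurry.obj K :=
      NatIso.ofComponents (fun _ => Iso.refl _) (fun f => (Category.comp_id _).trans (Eq.trans
        (show (K.obj m).map f = (K.map (𝟙 m)).app _ ≫ (K.obj m).map f by simp)
        (Category.id_comp _).symm))
    (h m).of_iso e⟩

end

section

variable {E : Type u} [Category.{v} E] [Preadditive E] [Linear k E] [MonoidalCategory E]

theorem isRightExactLinear_tensorLeft (hE : IsRightExactBilinear k (tensor E)) (e : E) :
    IsRightExactLinear k (tensorLeft e) :=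
  let i : Prod.sectR e E ⋙ tensor E ≅ tensorLeft e :=
    NatIso.ofComponents (fun _ => Iso.refl _) (fun f => (Category.comp_id _).trans (Eq.trans
      (show 𝟙 e ⊗ₘ f = e ◁ f by simp) (Category.id_comp _).symm))
  (hE.right e).of_iso i

theorem isRightExactLinear_tensorRight (hE : IsRightExactBilinear k (tensor E)) (e : E) :
    IsRightExactLinear k (tensorRight e) :=
  let i : Prod.sectL E e ⋙ tensor E ≅ tensorRight e :=
    NatIso.ofComponents (fun _ => Iso.refl _) (fun f => (Category.comp_id _).trans (Eq.trans
      (show f ⊗ₘ 𝟙 e = f ▷ e by simp) (Category.id_comp _).symm))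
  (hE.left e).of_iso i

end

section

variable {C : Type u₁} [Category.{v₁} C] [MonoidalCategory C]
    {D : Type u₂} [Category.{v₂} D] [MonoidalCategory D]
    {E : Type u} [Category.{v} E] [Preadditive E] [Linear k E] [MonoidalCategory E]
    {F : C × D ⥤ E} [F.Monoidal]
    {M : Type u₃} [Category.{v₃} M] [MonoidalLeftAction C M]
    {N : Type u₄} [Category.{v₄} N] [MonoidalLeftAction D N]
    {Q : Type u} [Category.{v} Q] [Preadditive Q] [Linear k Q] [MonoidalLeftAction E Q]
    {Q' : Type u} [Category.{v} Q'] [Preadditive Q'] [Linear k Q'] [MonoidalLeftAction E Q']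
    {P : M × N ⥤ Q} {P' : M × N ⥤ Q'}

namespace InducedAction

/-- The comparison between the action before and after applying `Φ`, on the objects coming from
the factors. -/
@[simps]
def lineator (I : InducedAction k F P) (I' : InducedAction k F P') {Φ : Q ⥤ Q'}
    (j : ∀ y, Φ.obj (P.obj y) ≅ P'.obj y) (x : C × D) (y : M × N) :
    F.obj x ⊙ₗ Φ.obj (P.obj y) ≅ Φ.obj (F.obj x ⊙ₗ P.obj y) where
  hom := F.obj x ⊴ₗ (j y).hom ≫ (I'.iso x.1 x.2 y.1 y.2).hom ≫
    (j (x.1 ⊙ₗ y.1, x.2 ⊙ₗ y.2)).inv ≫ Φ.map (I.iso x.1 x.2 y.1 y.2).inv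
  inv := Φ.map (I.iso x.1 x.2 y.1 y.2).hom ≫ (j (x.1 ⊙ₗ y.1, x.2 ⊙ₗ y.2)).hom ≫
    (I'.iso x.1 x.2 y.1 y.2).inv ≫ F.obj x ⊴ₗ (j y).inv
  hom_inv_id := by
    simp [← Functor.map_comp_assoc, ← MonoidalLeftAction.actionHomRight_comp]
  inv_hom_id := by
    simp [← MonoidalLeftAction.actionHomRight_comp_assoc, ← Functor.map_comp]

theorem lineator_naturality (I : InducedAction k F P) (I' : InducedAction k F P') {Φ : Q ⥤ Q'}
    (j : ∀ y, Φ.obj (P.obj y) ≅ P'.obj y)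
    (hj : ∀ {y y' : M × N} (g : y ⟶ y'),
      Φ.map (P.map g) ≫ (j y').hom = (j y).hom ≫ P'.map g)
    {x x' : C × D} (f : x ⟶ x') {y y' : M × N} (g : y ⟶ y') :
    (F.map f ⊙ₗₘ Φ.map (P.map g)) ≫ (I.lineator I' j x' y').hom =
      (I.lineator I' j x y).hom ≫ Φ.map (F.map f ⊙ₗₘ P.map g) := by
  have h : (F.map f ⊙ₗₘ P.map g) ≫ (I.iso x'.1 x'.2 y'.1 y'.2).hom =
      (I.iso x.1 x.2 y.1 y.2).hom ≫ P.map ((f.1 ⊙ₗₘ g.1) ×ₘ (f.2 ⊙ₗₘ g.2)) :=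
    I.naturality f.1 f.2 g.1 g.2
  have h' : (F.map f ⊙ₗₘ P'.map g) ≫ (I'.iso x'.1 x'.2 y'.1 y'.2).hom =
      (I'.iso x.1 x.2 y.1 y.2).hom ≫ P'.map ((f.1 ⊙ₗₘ g.1) ×ₘ (f.2 ⊙ₗₘ g.2)) :=
    I'.naturality f.1 f.2 g.1 g.2
  have hj' : P'.map ((f.1 ⊙ₗₘ g.1) ×ₘ (f.2 ⊙ₗₘ g.2)) ≫ (j (x'.1 ⊙ₗ y'.1, x'.2 ⊙ₗ y'.2)).inv =
      (j (x.1 ⊙ₗ y.1, x.2 ⊙ₗ y.2)).inv ≫ Φ.map (P.map ((f.1 ⊙ₗₘ g.1) ×ₘ (f.2 ⊙ₗₘ g.2))) := by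
    rw [Iso.comp_inv_eq, Category.assoc, hj, Iso.inv_hom_id_assoc]
  have h1 : (F.map f ⊙ₗₘ Φ.map (P.map g)) ≫ F.obj x' ⊴ₗ (j y').hom =
      F.obj x ⊴ₗ (j y).hom ≫ (F.map f ⊙ₗₘ P'.map g) := by
    rw [← MonoidalLeftAction.id_actionHom, ← MonoidalLeftAction.id_actionHom,
      ← MonoidalLeftAction.actionHom_comp, ← MonoidalLeftAction.actionHom_comp, hj]
    simp
  have h2 : P.map ((f.1 ⊙ₗₘ g.1) ×ₘ (f.2 ⊙ₗₘ g.2)) ≫ (I.iso x'.1 x'.2 y'.1 y'.2).inv =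
      (I.iso x.1 x.2 y.1 y.2).inv ≫ (F.map f ⊙ₗₘ P.map g) := by
    rw [Iso.comp_inv_eq, Category.assoc, h, Iso.inv_hom_id_assoc]
  rw [lineator_hom, lineator_hom, reassoc_of% h1, reassoc_of% h', reassoc_of% hj',
    ← Φ.map_comp, h2, Φ.map_comp]
  simp only [Category.assoc]

theorem lineator_comp_iso (I : InducedAction k F P) (I' : InducedAction k F P') {Φ : Q ⥤ Q'}
    (j : ∀ y, Φ.obj (P.obj y) ≅ P'.obj y) (c : C) (d : D) (m : M) (n : N) :
    (I.lineator I' j (c, d) (m, n)).hom ≫ Φ.map (I.iso c d m n).hom =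
      F.obj (c, d) ⊴ₗ (j (m, n)).hom ≫ (I'.iso c d m n).hom ≫ (j (c ⊙ₗ m, d ⊙ₗ n)).inv := by
  simp [← Functor.map_comp]

end InducedAction

end

section

variable {C : Type u₁} [Category.{v₁} C] [Preadditive C] [Linear k C] [MonoidalCategory C]
    {D : Type u₂} [Category.{v₂} D] [Preadditive D] [Linear k D] [MonoidalCategory D]
    {E : Type u} [Category.{v} E] [Abelian E] [Linear k E] [MonoidalCategory E]
    {F : C × D ⥤ E} [F.Monoidal]
    {M : Type u₃} [Category.{v₃} M] [Preadditive M] [Linear k M] [MonoidalLeftAction C M]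
    {N : Type u₄} [Category.{v₄} N] [Preadditive N] [Linear k N] [MonoidalLeftAction D N]
    {Q : Type u} [Category.{v} Q] [Abelian Q] [Linear k Q] [MonoidalLeftAction E Q]
    {Q' : Type u} [Category.{v} Q'] [Abelian Q'] [Linear k Q'] [MonoidalLeftAction E Q']
    {P : M × N ⥤ Q} {P' : M × N ⥤ Q'}

namespace InducedAction

theorem exists_lineator (hF : IsDeligneProduct k F) (hP : IsDeligneProduct k P)
    (I : InducedAction k F P) (I' : InducedAction k F P') {Φ : Q ⥤ Q'}
    (hΦ : IsRightExactLinear k Φ) (j : ∀ y, Φ.obj (P.obj y) ≅ P'.obj y)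
    (hj : ∀ {y y' : M × N} (g : y ⟶ y'),
      Φ.map (P.map g) ≫ (j y').hom = (j y).hom ≫ P'.map g) :
    ∃ δ : ∀ (e : E) (q : Q), e ⊙ₗ Φ.obj q ≅ Φ.obj (e ⊙ₗ q),
      (∀ {e e' : E} (f : e ⟶ e') (q : Q),
        f ⊵ₗ Φ.obj q ≫ (δ e' q).hom = (δ e q).hom ≫ Φ.map (f ⊵ₗ q)) ∧
      (∀ (e : E) {q q' : Q} (g : q ⟶ q'),
        e ⊴ₗ Φ.map g ≫ (δ e q').hom = (δ e q).hom ≫ Φ.map (e ⊴ₗ g)) ∧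
      ∀ x y, (δ (F.obj x) (P.obj y)).hom = (I.lineator I' j x y).hom := by
  let K := Functor.uncurry.obj (MonoidalLeftAction.curriedAction E Q')
  let K' := Functor.uncurry.obj (MonoidalLeftAction.curriedAction E Q)
  have hK : IsRightExactBilinear k ((𝟭 E).prod Φ ⋙ K) :=
    I'.bilinear.prod_comp ⟨inferInstance, inferInstance, inferInstance⟩ hΦ
  have hK' : IsRightExactBilinear k (K' ⋙ Φ) := I.bilinear.comp k hΦ
  have K_map {e e' : E} {q q' : Q'} (f : e ⟶ e') (g : q ⟶ q') :
    K.map (f ×ₘ g) = f ⊙ₗₘ g := (MonoidalLeftAction.actionHom_def f g).symm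
  have K'_map {e e' : E} {q q' : Q} (f : e ⟶ e') (g : q ⟶ q') :
    K'.map (f ×ₘ g) = f ⊙ₗₘ g := (MonoidalLeftAction.actionHom_def f g).symm
  let t : F.prod P ⋙ (𝟭 E).prod Φ ⋙ K ≅ F.prod P ⋙ K' ⋙ Φ :=
    NatIso.ofComponents (fun z => I.lineator I' j z.1 z.2) (fun {z z'} h =>
      (congrArg (· ≫ _) (K_map _ _)).trans ((I.lineator_naturality I' j hj h.1 h.2).trans
        (congrArg (fun f => _ ≫ Φ.map f) (K'_map _ _).symm)))
  obtain ⟨δ, hδ⟩ := hF.exists_natIso₂ hP hK hK' t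
  refine ⟨fun e q => δ.app (e, q), fun {e e'} f q => ?_, fun e {q q'} g => ?_,
    fun x y => hδ x y⟩
  · have h1 : K.map (f ×ₘ Φ.map (𝟙 q)) = f ⊵ₗ Φ.obj q :=
      (K_map _ _).trans ((congrArg (f ⊙ₗₘ ·) (Φ.map_id q)).trans
        (MonoidalLeftAction.actionHom_id f _))
    have h2 : K'.map (f ×ₘ 𝟙 q) = f ⊵ₗ q :=
      (K'_map _ _).trans (MonoidalLeftAction.actionHom_id f _)
    rw [← h1, ← h2]
    exact δ.hom.naturality (f ×ₘ 𝟙 q)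
  · have h1 : K.map (𝟙 e ×ₘ Φ.map g) = e ⊴ₗ Φ.map g :=
      (K_map _ _).trans (MonoidalLeftAction.id_actionHom e _)
    have h2 : K'.map (𝟙 e ×ₘ g) = e ⊴ₗ g :=
      (K'_map _ _).trans (MonoidalLeftAction.id_actionHom e _)
    rw [← h1, ← h2]
    exact δ.hom.naturality (𝟙 e ×ₘ g)

section

variable (I : InducedAction k F P) (I' : InducedAction k F P')
    {Φ : Q ⥤ Q'} (j : ∀ y, Φ.obj (P.obj y) ≅ P'.obj y)
    (hj : ∀ {y y' : M × N} (g : y ⟶ y'),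
      Φ.map (P.map g) ≫ (j y').hom = (j y).hom ≫ P'.map g)
    (δ : ∀ (e : E) (q : Q), e ⊙ₗ Φ.obj q ≅ Φ.obj (e ⊙ₗ q))
    (hl : ∀ {e e' : E} (f : e ⟶ e') (q : Q),
        f ⊵ₗ Φ.obj q ≫ (δ e' q).hom = (δ e q).hom ≫ Φ.map (f ⊵ₗ q))
    (hr : ∀ (e : E) {q q' : Q} (g : q ⟶ q'),
        e ⊴ₗ Φ.map g ≫ (δ e q').hom = (δ e q).hom ≫ Φ.map (e ⊴ₗ g))
    (hδ : ∀ x y, (δ (F.obj x) (P.obj y)).hom = (I.lineator I' j x y).hom)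

open MonoidalLeftAction

omit [Preadditive C] [Linear k C] [Preadditive D] [Linear k D] [Preadditive M] [Linear k M]
  [Preadditive N] [Linear k N]

include hδ in
theorem lineator_comp_iso_aux (c : C) (d : D) (m : M) (n : N) :
    (δ (F.obj (c, d)) (P.obj (m, n))).hom ≫ Φ.map (I.iso c d m n).hom =
      F.obj (c, d) ⊴ₗ (j (m, n)).hom ≫ (I'.iso c d m n).hom ≫ (j (c ⊙ₗ m, d ⊙ₗ n)).inv := by
  rw [hδ, lineator_comp_iso]

include hj hl hδ in
theorem lineator_unitality_aux (m : M) (n : N) :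
    (λₗ (Φ.obj (P.obj (m, n)))).hom =
      (δ (𝟙_ E) (P.obj (m, n))).hom ≫ Φ.map (λₗ (P.obj (m, n))).hom := by
  have hj' : (j (𝟙_ C ⊙ₗ m, 𝟙_ D ⊙ₗ n)).inv ≫
      Φ.map (P.map ((λₗ m).hom ×ₘ (λₗ n).hom)) =
        P'.map ((λₗ m).hom ×ₘ (λₗ n).hom) ≫ (j (m, n)).inv := by
    rw [Iso.inv_comp_eq, ← reassoc_of% hj, Iso.hom_inv_id, Category.comp_id]
  have hc := I.lineator_comp_iso_aux I' j δ hδ (𝟙_ C) (𝟙_ D) m n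
  have hl' := hl (Functor.LaxMonoidal.ε F) (P.obj (m, n))
  have h' := I'.unitality m n
  dsimp only [prodMonoidal_tensorUnit] at hl' h'
  rw [← I.unitality, Φ.map_comp, Φ.map_comp]
  dsimp only [prodMonoidal_tensorUnit]
  rw [← reassoc_of% hl', reassoc_of% hc, hj', ← action_exchange_assoc,
    reassoc_of% h', ← actionUnitIso_hom_naturality_assoc, Iso.hom_inv_id, Category.comp_id]

include hj hl hr hδ in
theorem lineator_associativity_aux (c c' : C) (d d' : D) (m : M) (n : N) :
    (δ (F.obj (c, d) ⊗ F.obj (c', d')) (P.obj (m, n))).hom ≫ Φ.map (αₗ _ _ _).hom =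
      (αₗ (F.obj (c, d)) (F.obj (c', d')) (Φ.obj (P.obj (m, n)))).hom ≫
        F.obj (c, d) ⊴ₗ (δ (F.obj (c', d')) (P.obj (m, n))).hom ≫
          (δ (F.obj (c, d)) (F.obj (c', d') ⊙ₗ P.obj (m, n))).hom := by
  have h := I.associativity c c' d d' m n
  have h' := I'.associativity c c' d d' m n
  have hj' : (j ((c ⊗ c') ⊙ₗ m, (d ⊗ d') ⊙ₗ n)).inv ≫
      Φ.map (P.map ((αₗ c c' m).hom ×ₘ (αₗ d d' n).hom)) =
        P'.map ((αₗ c c' m).hom ×ₘ (αₗ d d' n).hom) ≫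
          (j (c ⊙ₗ c' ⊙ₗ m, d ⊙ₗ d' ⊙ₗ n)).inv := by
    rw [Iso.inv_comp_eq, ← reassoc_of% hj, Iso.hom_inv_id, Category.comp_id]
  have hc := I.lineator_comp_iso_aux I' j δ hδ
  have hl' := hl (Functor.LaxMonoidal.μ F (c, d) (c', d')) (P.obj (m, n))
  dsimp only [prodMonoidal_tensorObj] at hl' h h'
  rw [← cancel_mono (Φ.map (F.obj (c, d) ⊴ₗ (I.iso c' d' m n).hom ≫
    (I.iso c d (c' ⊙ₗ m) (d' ⊙ₗ n)).hom)), Category.assoc, ← Φ.map_comp, ← h,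
    Φ.map_comp, Φ.map_comp, ← reassoc_of% hl', reassoc_of% hc, hj', ← action_exchange_assoc,
    reassoc_of% h']
  simp only [Category.assoc, Φ.map_comp]
  rw [← reassoc_of% hr, hc, ← actionHomRight_comp_assoc, hc, tensor_actionHomRight]
  simp

end

section

open MonoidalLeftAction

/-- A family of morphisms `(e ⊗ e') ⊙ₗ Φ.obj q ⟶ Φ.obj (e ⊙ₗ e' ⊙ₗ q)` that is natural in each
variable. -/
structure IsNaturalFamily {E : Type u} [Category.{v} E] [MonoidalCategory E]
    {Q : Type u} [Category.{v} Q] [MonoidalLeftAction E Q]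
    {Q' : Type u} [Category.{v} Q'] [MonoidalLeftAction E Q'] {Φ : Q ⥤ Q'}
    (L : ∀ (e e' : E) (q : Q), (e ⊗ e') ⊙ₗ Φ.obj q ⟶ Φ.obj (e ⊙ₗ e' ⊙ₗ q)) : Prop where
  left {e₁ e₂ : E} (f : e₁ ⟶ e₂) (e' : E) (q : Q) :
    (f ▷ e') ⊵ₗ Φ.obj q ≫ L e₂ e' q = L e₁ e' q ≫ Φ.map (f ⊵ₗ (e' ⊙ₗ q))
  middle (e : E) {e₁ e₂ : E} (f : e₁ ⟶ e₂) (q : Q) :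
    (e ◁ f) ⊵ₗ Φ.obj q ≫ L e e₂ q = L e e₁ q ≫ Φ.map (e ⊴ₗ f ⊵ₗ q)
  right (e e' : E) {q₁ q₂ : Q} (g : q₁ ⟶ q₂) :
    (e ⊗ e') ⊴ₗ Φ.map g ≫ L e e' q₂ = L e e' q₁ ≫ Φ.map (e ⊴ₗ e' ⊴ₗ g)

theorem naturalFamily_ext (hE : IsRightExactBilinear k (tensor E)) (hF : IsDeligneProduct k F)
    (hP : IsDeligneProduct k P) (I : InducedAction k F P) (I' : InducedAction k F P')
    {Φ : Q ⥤ Q'} (hΦ : IsRightExactLinear k Φ)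
    {L R : ∀ (e e' : E) (q : Q), (e ⊗ e') ⊙ₗ Φ.obj q ⟶ Φ.obj (e ⊙ₗ e' ⊙ₗ q)}
    (hL : IsNaturalFamily L) (hR : IsNaturalFamily R)
    (h : ∀ x x' y, L (F.obj x) (F.obj x') (P.obj y) = R (F.obj x) (F.obj x') (P.obj y)) :
    L = R := by
  have h₁ (e x' y) : L e (F.obj x') (P.obj y) = R e (F.obj x') (P.obj y) := by
    let H := tensorRight (F.obj x') ⋙ (curriedAction E Q').flip.obj (Φ.obj (P.obj y))
    let H' := (curriedAction E Q).flip.obj (F.obj x' ⊙ₗ P.obj y) ⋙ Φ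
    let α : H ⟶ H' :=
      { app e := L e (F.obj x') (P.obj y), naturality _ _ f := hL.left f _ _ }
    let β : H ⟶ H' :=
      { app e := R e (F.obj x') (P.obj y), naturality _ _ f := hR.left f _ _ }
    exact NatTrans.congr_app (hF.natTrans_ext
      ((isRightExactLinear_tensorRight hE _).comp k (I'.bilinear.flip_obj _))
      ((I.bilinear.flip_obj _).comp k hΦ) α β fun x => h x x' y) e
  have h₂ (e e' y) : L e e' (P.obj y) = R e e' (P.obj y) := by
    let H := tensorLeft e ⋙ (curriedAction E Q').flip.obj (Φ.obj (P.obj y))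
    let H' := (curriedAction E Q).flip.obj (P.obj y) ⋙ (curriedAction E Q).obj e ⋙ Φ
    let α : H ⟶ H' :=
      { app e' := L e e' (P.obj y), naturality _ _ f := hL.middle _ f _ }
    let β : H ⟶ H' :=
      { app e' := R e e' (P.obj y), naturality _ _ f := hR.middle _ f _ }
    exact NatTrans.congr_app (hF.natTrans_ext
      ((isRightExactLinear_tensorLeft hE _).comp k (I'.bilinear.flip_obj _))
      ((I.bilinear.flip_obj _).comp k ((I.bilinear.obj _).comp k hΦ)) α β
      fun x' => h₁ e x' y) e'
  funext e e' q
  let H := Φ ⋙ (curriedAction E Q').obj (e ⊗ e')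
  let H' := (curriedAction E Q).obj e' ⋙ (curriedAction E Q).obj e ⋙ Φ
  let α : H ⟶ H' := { app q := L e e' q, naturality _ _ g := hL.right _ _ g }
  let β : H ⟶ H' := { app q := R e e' q, naturality _ _ g := hR.right _ _ g }
  exact NatTrans.congr_app (hP.natTrans_ext (hΦ.comp k (I'.bilinear.obj _))
    ((I.bilinear.obj _).comp k ((I.bilinear.obj _).comp k hΦ)) α β fun y => h₂ e e' y) q

end

/-- A right exact functor out of a Deligne product that is compatible with the universal bilinear
functors is a functor of module categories for the induced actions. -/
theorem nonempty_leftLinear (hE : IsRightExactBilinear k (tensor E)) (hF : IsDeligneProduct k F)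
    (hP : IsDeligneProduct k P) (I : InducedAction k F P) (I' : InducedAction k F P')
    {Φ : Q ⥤ Q'} (hΦ : IsRightExactLinear k Φ) (i : P ⋙ Φ ≅ P') :
    Nonempty (Φ.LeftLinear E) := by
  obtain ⟨j, hj⟩ : ∃ j : ∀ y, Φ.obj (P.obj y) ≅ P'.obj y, ∀ {y y' : M × N} (g : y ⟶ y'),
      Φ.map (P.map g) ≫ (j y').hom = (j y).hom ≫ P'.map g :=
    ⟨fun y => i.app y, fun g => i.hom.naturality g⟩
  obtain ⟨δ, hl, hr, hδ⟩ := I.exists_lineator hF hP I' hΦ j hj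
  have unit (q : Q) : (λₗ (Φ.obj q)).hom = (δ (𝟙_ E) q).hom ≫ Φ.map (λₗ q).hom := by
    have nat {q q' : Q} (g : q ⟶ q') : 𝟙_ E ⊴ₗ Φ.map g ≫ (δ (𝟙_ E) q').hom ≫ Φ.map (λₗ q').hom =
        ((δ (𝟙_ E) q).hom ≫ Φ.map (λₗ q).hom) ≫ Φ.map g := by
      rw [reassoc_of% hr (𝟙_ E) g, Category.assoc, ← Φ.map_comp, ← Φ.map_comp,
        MonoidalLeftAction.actionUnitIso_hom_naturality]
    let α : Φ ⋙ (MonoidalLeftAction.curriedAction E Q').obj (𝟙_ E) ⟶ Φ :=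
      { app q := (λₗ (Φ.obj q)).hom
        naturality _ _ g := (MonoidalLeftAction.actionUnitIso_hom_naturality (Φ.map g)).symm }
    let β : Φ ⋙ (MonoidalLeftAction.curriedAction E Q').obj (𝟙_ E) ⟶ Φ :=
      { app q := (δ (𝟙_ E) q).hom ≫ Φ.map (λₗ q).hom
        naturality q q' g := nat g }
    exact NatTrans.congr_app (hP.natTrans_ext (hΦ.comp k (I'.bilinear.obj _)) hΦ α β
      fun y => I.lineator_unitality_aux I' j hj δ hl hδ y.1 y.2) q
  have hL : IsNaturalFamily (Φ := Φ)
      (fun (e e' : E) (q : Q) => (δ (e ⊗ e') q).hom ≫ Φ.map (αₗ e e' q).hom) := by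
    constructor
    · intro e₁ e₂ f e' q
      rw [reassoc_of% hl, Category.assoc, ← Φ.map_comp, ← Φ.map_comp]
      simp
    · intro e e₁ e₂ f q
      rw [reassoc_of% hl, Category.assoc, ← Φ.map_comp, ← Φ.map_comp]
      simp
    · intro e e' q₁ q₂ g
      rw [reassoc_of% hr, Category.assoc, ← Φ.map_comp, ← Φ.map_comp]
      simp
  have hR : IsNaturalFamily (Φ := Φ) (fun (e e' : E) (q : Q) =>
      (αₗ e e' (Φ.obj q)).hom ≫ e ⊴ₗ (δ e' q).hom ≫ (δ e (e' ⊙ₗ q)).hom) := by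
    constructor
    · intro e₁ e₂ f e' q
      rw [MonoidalLeftAction.whiskerRight_actionHomLeft]
      simp only [Category.assoc, Iso.inv_hom_id_assoc]
      rw [← MonoidalLeftAction.action_exchange_assoc, hl]
    · intro e e₁ e₂ f q
      rw [MonoidalLeftAction.whiskerLeft_actionHomLeft]
      simp only [Category.assoc, Iso.inv_hom_id_assoc]
      rw [← MonoidalLeftAction.actionHomRight_comp_assoc, hl,
        MonoidalLeftAction.actionHomRight_comp_assoc, hr]
    · intro e e' q₁ q₂ g
      rw [MonoidalLeftAction.tensor_actionHomRight]
      simp only [Category.assoc, Iso.inv_hom_id_assoc]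
      rw [← MonoidalLeftAction.actionHomRight_comp_assoc, hr,
        MonoidalLeftAction.actionHomRight_comp_assoc, hr]
  have assoc := naturalFamily_ext hE hF hP I I' hΦ hL hR fun x x' y =>
    I.lineator_associativity_aux I' j hj δ hl hr hδ x.1 x'.1 x.2 x'.2 y.1 y.2
  replace assoc (e e' : E) (q : Q) := congrFun (congrFun (congrFun assoc e) e') q
  exact ⟨{
    μₗ e q := (δ e q).hom
    μₗ_naturality_left := hl
    μₗ_naturality_right := hr
    μₗ_associativity := assoc
    μₗ_unitality := unit
    δₗ e q := (δ e q).inv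
    δₗ_naturality_left f q := by
      rw [Iso.comp_inv_eq, Category.assoc, hl, Iso.inv_hom_id_assoc]
    δₗ_naturality_right e _ _ g := by
      rw [Iso.comp_inv_eq, Category.assoc, hr, Iso.inv_hom_id_assoc]
    δₗ_associativity e e' q := by
      have := assoc e e' q
      rw [Iso.inv_comp_eq, ← Category.assoc, ← Category.assoc, this]
      simp
    δₗ_unitality_inv q := by
      rw [← cancel_epi (λₗ[E] (Φ.obj q)).hom, Iso.hom_inv_id, unit]
      simp [← Φ.map_comp_assoc]
    μₗ_comp_δₗ e q := (δ e q).hom_inv_id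
    δₗ_comp_μₗ e q := (δ e q).inv_hom_id }⟩

end InducedAction

end

end

/-! ### Transport of module categories along fully faithful functors -/

section

universe v₁ v₂ v₃ v₄ u₁ u₂ u₃ u₄

section

variable {E : Type u} [Category.{v} E] [MonoidalCategory E]
    {Q : Type u₁} [Category.{v₁} Q] {S : Type u₂} [Category.{v₂} S] [MonoidalLeftAction E S]

open MonoidalLeftAction

/-- The left action on `Q` that makes a fully faithful functor `Φ : Q ⥤ S` a functor of module
categories. -/
@[reducible]
noncomputable def MonoidalLeftAction.ofFullyFaithful (Φ : Q ⥤ S) [Φ.Full] [Φ.Faithful] (ψ : E → Q → Q)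
    (θ : ∀ e q, Φ.obj (ψ e q) ≅ e ⊙ₗ Φ.obj q) : MonoidalLeftAction E Q where
  actionObj := ψ
  actionHomLeft {e e'} f q := Φ.preimage ((θ e q).hom ≫ f ⊵ₗ Φ.obj q ≫ (θ e' q).inv)
  actionHomRight e {q q'} g := Φ.preimage ((θ e q).hom ≫ e ⊴ₗ Φ.map g ≫ (θ e q').inv)
  actionHom {e e' q q'} f g := Φ.preimage ((θ e q).hom ≫ (f ⊙ₗₘ Φ.map g) ≫ (θ e' q').inv)
  actionAssocIso e e' q := Φ.preimageIso (θ (e ⊗ e') q ≪≫ αₗ e e' (Φ.obj q) ≪≫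
    ⟨e ⊴ₗ (θ e' q).inv, e ⊴ₗ (θ e' q).hom, by simp, by simp⟩ ≪≫ (θ e (ψ e' q)).symm)
  actionUnitIso q := Φ.preimageIso (θ (𝟙_ E) q ≪≫ λₗ (Φ.obj q))
  actionHom_def f g := Φ.map_injective (by simp [actionHom_def])
  actionHomRight_id e q := Φ.map_injective (by simp)
  id_actionHomLeft e q := Φ.map_injective (by simp)
  actionHom_comp f₁ f₂ g₁ g₂ := Φ.map_injective (by simp)
  actionAssocIso_hom_naturality {c₁ c₂ c₃ c₄ d₁ d₂} f g h := Φ.map_injective (by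
    simp [actionHom_def, action_exchange_assoc, MonoidalCategory.tensorHom_def])
  actionUnitIso_hom_naturality f := Φ.map_injective (by simp)
  whiskerLeft_actionHomLeft c _ _ f q := Φ.map_injective (by
    simp)
  whiskerRight_actionHomLeft c f q := Φ.map_injective (by
    simp [← action_exchange_assoc])
  associator_actionHom c₁ c₂ c₃ q := Φ.map_injective (by
    simp)
  leftUnitor_actionHom c q := Φ.map_injective (by
    simp)
  rightUnitor_actionHom c q := Φ.map_injective (by
    simp)

end

section

open MonoidalLeftAction

variable {k : Type w} [Field k]
    {C : Type u₁} [Category.{v₁} C] [MonoidalCategory C]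
    {D : Type u₂} [Category.{v₂} D] [MonoidalCategory D]
    {E : Type u} [Category.{v} E] [Preadditive E] [Linear k E] [MonoidalCategory E]
    {F : C × D ⥤ E} [F.Monoidal]
    {M : Type u₃} [Category.{v₃} M] [MonoidalLeftAction C M]
    {N : Type u₄} [Category.{v₄} N] [MonoidalLeftAction D N]
    {Q : Type u} [Category.{v} Q] [Preadditive Q] [Linear k Q]
    {S : Type u} [Category.{v} S] [Preadditive S] [Linear k S] [MonoidalLeftAction E S]
    {P : M × N ⥤ Q} {P' : M × N ⥤ S}

/-- An induced action can be transported along an equivalence. -/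
theorem InducedAction.exists_transport (I : InducedAction k F P') (e : Q ≌ S)
    (he : IsRightExactLinear k e.functor) (i : P ⋙ e.functor ≅ P') :
    ∃ _ : MonoidalLeftAction E Q, Nonempty (InducedAction k F P) := by
  obtain ⟨_, _, _⟩ := he
  let Φ := e.functor
  let θ (x : E) (q : Q) : Φ.obj (e.inverse.obj (x ⊙ₗ Φ.obj q)) ≅ x ⊙ₗ Φ.obj q :=
    e.counitIso.app _
  let act : MonoidalLeftAction E Q := MonoidalLeftAction.ofFullyFaithful Φ
    (fun x q => e.inverse.obj (x ⊙ₗ Φ.obj q)) θ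
  have hinv : IsRightExactLinear k e.inverse :=
    ⟨inferInstance, e.inverseLinear k, inferInstance⟩
  have he : IsRightExactLinear k Φ := ⟨inferInstance, inferInstance, inferInstance⟩
  have map_right (x : E) {q q' : Q} (g : q ⟶ q') :
      Φ.map (x ⊴ₗ g) = (θ x q).hom ≫ x ⊴ₗ Φ.map g ≫ (θ x q').inv := Φ.map_preimage _
  have map_left {x x' : E} (f : x ⟶ x') (q : Q) :
      Φ.map (f ⊵ₗ q) = (θ x q).hom ≫ f ⊵ₗ Φ.obj q ≫ (θ x' q).inv := Φ.map_preimage _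
  have map_both {x x' : E} (f : x ⟶ x') {q q' : Q} (g : q ⟶ q') :
      Φ.map (f ⊙ₗₘ g) = (θ x q).hom ≫ (f ⊙ₗₘ Φ.map g) ≫ (θ x' q').inv := Φ.map_preimage _
  have map_assoc (x x' : E) (q : Q) : Φ.map (αₗ x x' q).hom = (θ (x ⊗ x') q).hom ≫
      (αₗ x x' (Φ.obj q)).hom ≫ x ⊴ₗ (θ x' q).inv ≫ (θ x (x' ⊙ₗ q)).inv := Φ.map_preimage _
  have map_unit (q : Q) : Φ.map (λₗ[E] q).hom = (θ (𝟙_ E) q).hom ≫ (λₗ (Φ.obj q)).hom :=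
    Φ.map_preimage _
  obtain ⟨j, hj⟩ : ∃ j : ∀ y, Φ.obj (P.obj y) ≅ P'.obj y, ∀ {y y' : M × N} (g : y ⟶ y'),
      Φ.map (P.map g) ≫ (j y').hom = (j y).hom ≫ P'.map g :=
    ⟨fun y => i.app y, fun g => i.hom.naturality g⟩
  have hj' {y y' : M × N} (g : y ⟶ y') :
      (j y).inv ≫ Φ.map (P.map g) = P'.map g ≫ (j y').inv := by
    rw [Iso.inv_comp_eq, ← reassoc_of% hj, Iso.hom_inv_id, Category.comp_id]
  have reflect {T : Type u} [Category.{v} T] [Preadditive T] [Linear k T] {H : T ⥤ Q}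
      (h : IsRightExactLinear k (H ⋙ Φ)) : IsRightExactLinear k H :=
    (h.comp k hinv).of_iso (Functor.associator _ _ _ ≪≫ Functor.isoWhiskerLeft H e.unitIso.symm ≪≫
      H.rightUnitor)
  refine ⟨act, ⟨{
    bilinear := IsRightExactBilinear.of_obj (fun x => reflect ?_) (fun q => reflect ?_)
    iso c d m n := Φ.preimageIso (θ (F.obj (c, d)) (P.obj (m, n)) ≪≫
      ⟨F.obj (c, d) ⊴ₗ (j (m, n)).hom, F.obj (c, d) ⊴ₗ (j (m, n)).inv, by simp, by simp⟩ ≪≫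
      I.iso c d m n ≪≫ (j _).symm)
    naturality := ?_
    associativity := ?_
    unitality := ?_ }⟩⟩
  · let t : Φ ⋙ (curriedAction E S).obj x ≅ (curriedAction E Q).obj x ⋙ Φ :=
      NatIso.ofComponents (fun q => (θ x q).symm) (fun {q q'} g => by
        change x ⊴ₗ Φ.map g ≫ (θ x q').inv = (θ x q).inv ≫ Φ.map (x ⊴ₗ g)
        rw [map_right, Iso.inv_hom_id_assoc])
    exact (he.comp k (I.bilinear.obj x)).of_iso t
  · let t : (curriedAction E S).flip.obj (Φ.obj q) ≅ (curriedAction E Q).flip.obj q ⋙ Φ :=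
      NatIso.ofComponents (fun x => (θ x q).symm) (fun {x x'} f => by
        change f ⊵ₗ Φ.obj q ≫ (θ x' q).inv = (θ x q).inv ≫ Φ.map (f ⊵ₗ q)
        rw [map_left, Iso.inv_hom_id_assoc])
    exact (I.bilinear.flip_obj _).of_iso t
  · intro c c' d d' m m' n n' f g a b
    apply Φ.map_injective
    simp only [Φ.map_comp, map_both, Functor.preimageIso_hom, Functor.map_preimage, Iso.trans_hom,
      Iso.symm_hom, Category.assoc, Iso.inv_hom_id_assoc]
    have h : (F.map (f ×ₘ g) ⊙ₗₘ Φ.map (P.map (a ×ₘ b))) ≫ F.obj (c', d') ⊴ₗ (j (m', n')).hom =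
        F.obj (c, d) ⊴ₗ (j (m, n)).hom ≫ (F.map (f ×ₘ g) ⊙ₗₘ P'.map (a ×ₘ b)) := by
      rw [← id_actionHom, ← id_actionHom, ← actionHom_comp, ← actionHom_comp, hj]
      simp
    rw [hj', reassoc_of% h, reassoc_of% I.naturality]
  · intro c c' d d' m n
    apply Φ.map_injective
    simp only [Φ.map_comp, map_right, map_left, map_assoc, Functor.preimageIso_hom,
      Functor.map_preimage, Iso.trans_hom, Iso.symm_hom, Category.assoc, Iso.inv_hom_id_assoc]
    have h := I.associativity c c' d d' m n
    dsimp only [prodMonoidal_tensorObj] at h ⊢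
    rw [hj', Iso.inv_hom_id_assoc, ← action_exchange_assoc, reassoc_of% h,
      tensor_actionHomRight]
    simp
  · intro m n
    apply Φ.map_injective
    simp only [Φ.map_comp, map_left, map_unit, Functor.preimageIso_hom,
      Functor.map_preimage, Iso.trans_hom, Iso.symm_hom, Category.assoc]
    have h := I.unitality m n
    dsimp only [prodMonoidal_tensorUnit] at h ⊢
    rw [hj', Iso.inv_hom_id_assoc, ← action_exchange_assoc, reassoc_of% h,
      ← actionUnitIso_hom_naturality_assoc, Iso.hom_inv_id, Category.comp_id]

end

end

/-! ### The category of right modules -/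

section

universe v₁ v₂ u₁ u₂

namespace RightMod

variable {C : Type u} [Category.{v} C] [MonoidalCategory C] (B : C) [MonObj B]

/-- The forgetful functor from right modules. -/
@[simps]
def forget : RightMod B ⥤ C where
  obj M := M.X
  map f := Hom.hom f

instance : (forget B).Faithful := ⟨fun h => hom_ext h⟩

instance : (forget B).ReflectsIsomorphisms where
  reflects {M N} f hf := by
    have : IsIso (Hom.hom f) := hf
    exact (isoMk (asIso (Hom.hom f)) (Hom.act_hom f)).isIso_hom

variable {B} in
theorem act_assoc (M : RightMod B) :
    ((α_ M.X B B).hom ≫ M.X ◁ μ[B]) ≫ M.act = M.act ▷ B ≫ M.act := by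
  rw [Category.assoc, M.act_mul, Iso.hom_inv_id_assoc]

theorem whiskerLeft_whiskerLeft_mul (X : C) :
    X ◁ B ◁ μ[B] ≫ X ◁ μ[B] = X ◁ (α_ B B B).inv ≫ X ◁ μ[B] ▷ B ≫ X ◁ μ[B] := by
  simp only [← whiskerLeft_comp]
  rw [MonObj.mul_assoc_flip]

/-- The monad `X ↦ X ⊗ B`. -/
def tensorMonad : CategoryTheory.Monad C := CategoryTheory.Monad.mk (tensorRight B)
  { app := fun X => (ρ_ X).inv ≫ X ◁ η[B]
    naturality := fun X Y f => by simp [whisker_exchange] }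
  { app := fun X => (α_ X B B).hom ≫ X ◁ μ[B]
    naturality := fun X Y f => by simp [whisker_exchange] }
  (fun X => by
    change ((α_ X B B).hom ≫ X ◁ μ[B]) ▷ B ≫ (α_ X B B).hom ≫ X ◁ μ[B] =
      ((α_ (X ⊗ B) B B).hom ≫ (X ⊗ B) ◁ μ[B]) ≫ (α_ X B B).hom ≫ X ◁ μ[B]
    simp [whiskerLeft_whiskerLeft_mul])
  (fun X => by
    change ((ρ_ (X ⊗ B)).inv ≫ (X ⊗ B) ◁ η[B]) ≫ (α_ X B B).hom ≫ X ◁ μ[B] = 𝟙 (X ⊗ B)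
    rw [Category.assoc, associator_naturality_right_assoc, ← whiskerLeft_comp,
      MonObj.mul_one]
    simp)
  (fun X => by
    change ((ρ_ X).inv ≫ X ◁ η[B]) ▷ B ≫ (α_ X B B).hom ≫ X ◁ μ[B] = 𝟙 (X ⊗ B)
    rw [comp_whiskerRight, Category.assoc, associator_naturality_middle_assoc,
      ← whiskerLeft_comp, MonObj.one_mul]
    simp)

/-- Right modules are algebras over the monad `X ↦ X ⊗ B`. -/
@[simps]
def toAlgebra : RightMod B ⥤ (tensorMonad B).Algebra where
  obj M :=
    { A := M.X
      a := M.act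
      unit := by
        change ((ρ_ M.X).inv ≫ M.X ◁ η[B]) ≫ M.act = 𝟙 _
        rw [Category.assoc, M.act_one, Iso.inv_hom_id]
      assoc := M.act_assoc }
  map f := { f := Hom.hom f, h := (Hom.act_hom f).symm }

instance : (toAlgebra B).Faithful := ⟨fun h => hom_ext (congrArg (fun f => f.f) h)⟩

instance : (toAlgebra B).Full := ⟨fun f => ⟨⟨f.f, f.h.symm⟩, rfl⟩⟩

instance : (toAlgebra B).EssSurj := ⟨fun M =>
  ⟨{ X := M.A
     act := M.a
     act_one := by
       have h : ((ρ_ M.A).inv ≫ M.A ◁ η[B]) ≫ M.a = 𝟙 _ := M.unit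
       exact (((Iso.inv_comp_eq _).1 ((Category.assoc _ _ _).symm.trans h))).trans
         (Category.comp_id _)
     act_mul := by
       have h : ((α_ M.A B B).hom ≫ M.A ◁ μ[B]) ≫ M.a = M.a ▷ B ≫ M.a := M.assoc
       exact (Iso.eq_inv_comp _).2 ((Category.assoc _ _ _).symm.trans h) }, ⟨Iso.refl _⟩⟩⟩

instance : (toAlgebra B).IsEquivalence where

noncomputable instance : CreatesLimitsOfSize.{v₁, u₁} (forget B) :=
  inferInstanceAs (CreatesLimitsOfSize.{v₁, u₁} (toAlgebra B ⋙ (tensorMonad B).forget))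

noncomputable instance {J : Type u₁} [Category.{v₁} J]
    [PreservesColimitsOfShape J (tensorRight B)] :
    CreatesColimitsOfShape J (forget B) :=
  have : PreservesColimitsOfShape J (tensorMonad B).toFunctor :=
    inferInstanceAs (PreservesColimitsOfShape J (tensorRight B))
  inferInstanceAs (CreatesColimitsOfShape J (toAlgebra B ⋙ (tensorMonad B).forget))

section

variable [HasFiniteLimits C]

instance : HasFiniteLimits (RightMod B) :=
  ⟨fun _ _ _ => hasLimitsOfShape_of_hasLimitsOfShape_createsLimitsOfShape (forget B)⟩

end

section

variable [HasFiniteColimits C] [PreservesFiniteColimits (tensorRight B)]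

instance : HasFiniteColimits (RightMod B) :=
  ⟨fun _ _ _ => hasColimitsOfShape_of_hasColimitsOfShape_createsColimitsOfShape (forget B)⟩

instance : PreservesFiniteColimits (forget B) := ⟨fun _ _ _ => inferInstance⟩

end

instance [Preadditive C] [MonoidalPreadditive C] : (forget B).Additive where

instance {k : Type w} [Field k] [Preadditive C] [MonoidalPreadditive C] [Linear k C]
    [MonoidalLinear k C] : (forget B).Linear k where

/-- Right modules over an algebra for which `X ↦ X ⊗ B` is right exact form an abelian
category. -/
@[reducible]
noncomputable def abelian [Abelian C] [MonoidalPreadditive C]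
    [PreservesFiniteColimits (tensorRight B)] : Abelian (RightMod B) :=
  have : HasFiniteProducts (RightMod B) := ⟨fun _ => inferInstance⟩
  have {M N : RightMod B} (f : M ⟶ N) : IsIso (Abelian.coimageImageComparison f) := by
    have := IsIso.of_isIso_fac_right (Abelian.PreservesCoimage.hom_coimageImageComparison (forget B) f).symm
    exact isIso_of_reflects_iso _ (forget B)
  Abelian.ofCoimageImageComparisonIsIso

section

variable {k : Type w} [Field k] [Abelian C] [MonoidalPreadditive C] [Linear k C]
    [MonoidalLinear k C] [PreservesFiniteColimits (tensorRight B)]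

theorem isRightExactLinear_forget : IsRightExactLinear k (forget B) :=
  ⟨inferInstance, inferInstance, inferInstance⟩

variable {B}

theorem isRightExactLinear_of_comp_forget {T : Type u₁} [Category.{v₁} T] [Preadditive T]
    [Linear k T] {H : T ⥤ RightMod B} (h : IsRightExactLinear k (H ⋙ forget B)) :
    IsRightExactLinear k H where
  additive := ⟨fun {_ _ f g} => (forget B).map_injective (h.additive.map_add (f := f) (g := g))⟩
  linear := ⟨fun f r => (forget B).map_injective (h.linear.map_smul f r)⟩
  rightExact := ⟨fun J _ _ => by
    have := h.rightExact
    have : PreservesColimitsOfShape J (H ⋙ forget B) := inferInstance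
    exact preservesColimitsOfShape_of_reflects_of_preserves H (forget B)⟩

end

/-- The free right module functor. -/
@[simps]
def free : C ⥤ RightMod B where
  obj X :=
    { X := X ⊗ B
      act := (α_ X B B).hom ≫ X ◁ μ[B]
      act_one := by
        rw [associator_naturality_right_assoc, ← whiskerLeft_comp, MonObj.mul_one]
        simp
      act_mul := by simp [whiskerLeft_whiskerLeft_mul] }
  map f := ⟨f ▷ B, by simp [whisker_exchange]⟩
  map_id X := hom_ext (by simp)
  map_comp f g := hom_ext (by simp)

theorem isRightExactLinear_free {k : Type w} [Field k] [Abelian C] [MonoidalPreadditive C]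
    [Linear k C] [MonoidalLinear k C] [PreservesFiniteColimits (tensorRight B)] :
    IsRightExactLinear k (free B) :=
  isRightExactLinear_of_comp_forget (H := free B)
    (⟨inferInstanceAs (tensorRight B).Additive, inferInstanceAs ((tensorRight B).Linear k),
      inferInstanceAs (PreservesFiniteColimits (tensorRight B))⟩ :
      IsRightExactLinear k (tensorRight B))

variable {B}

/-- The action, as a morphism of modules from a free module. -/
@[simps]
def counit (M : RightMod B) : (free B).obj M.X ⟶ M := ⟨M.act, M.act_assoc⟩

theorem counit_naturality {M N : RightMod B} (f : M ⟶ N) :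
    (free B).map (Hom.hom f) ≫ counit N = counit M ≫ f :=
  hom_ext (Hom.act_hom f).symm

variable (B) in
/-- The multiplication, as a morphism of free modules. -/
@[simps]
def freeMul (X : C) : (free B).obj (X ⊗ B) ⟶ (free B).obj X :=
  ⟨(α_ X B B).hom ≫ X ◁ μ[B], ((free B).obj X).act_assoc⟩

theorem freeMul_naturality {X Y : C} (f : X ⟶ Y) :
    (free B).map (f ▷ B) ≫ freeMul B Y = freeMul B X ≫ (free B).map f :=
  counit_naturality ((free B).map f)

theorem bar_condition (M : RightMod B) :
    (free B).map M.act ≫ counit M = freeMul B M.X ≫ counit M :=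
  hom_ext M.act_assoc.symm

theorem act_one_desc (M : RightMod B) {Y : C} (f : M.X ⊗ B ⟶ Y)
    (w : M.act ▷ B ≫ f = ((α_ M.X B B).hom ≫ M.X ◁ μ[B]) ≫ f) :
    M.act ≫ (ρ_ M.X).inv ≫ M.X ◁ η[B] ≫ f = f := by
  rw [rightUnitor_inv_naturality_assoc, ← whisker_exchange_assoc, w, Category.assoc,
    associator_naturality_right_assoc, ← whiskerLeft_comp_assoc, MonObj.mul_one]
  simp

theorem free_act_hom {X : C} {N : RightMod B} (f : X ⊗ B ⟶ N.X)
    (hf : ((α_ X B B).hom ≫ X ◁ μ[B]) ≫ f = f ▷ B ≫ N.act) :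
    ((ρ_ X).inv ≫ X ◁ η[B] ≫ f) ▷ B ≫ N.act = f := by
  rw [comp_whiskerRight, comp_whiskerRight, Category.assoc, Category.assoc, ← hf, Category.assoc,
    associator_naturality_middle_assoc, ← whiskerLeft_comp_assoc, MonObj.one_mul]
  simp

/-- Morphisms out of a module, constructed from its presentation by free modules. -/
def barDesc {M N : RightMod B} (f : (free B).obj M.X ⟶ N)
    (w : (free B).map M.act ≫ f = freeMul B M.X ≫ f) : M ⟶ N where
  hom := (ρ_ M.X).inv ≫ M.X ◁ η[B] ≫ Hom.hom f
  act_hom := (M.act_one_desc (Hom.hom f) (congrArg (fun f => Hom.hom f) w)).trans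
    (free_act_hom (Hom.hom f) (Hom.act_hom f)).symm

@[simp]
theorem counit_barDesc {M N : RightMod B} (f : (free B).obj M.X ⟶ N)
    (w : (free B).map M.act ≫ f = freeMul B M.X ≫ f) : counit M ≫ barDesc f w = f :=
  hom_ext (M.act_one_desc (Hom.hom f) (congrArg (fun f => Hom.hom f) w))

instance (M : RightMod B) : Epi (counit M) where
  left_cancellation {N} f g h := by
    apply hom_ext
    have h' : M.act ≫ Hom.hom f = M.act ≫ Hom.hom g := congrArg (fun f => Hom.hom f) h
    have : (ρ_ M.X).inv ≫ M.X ◁ η[B] ≫ M.act ≫ Hom.hom f =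
        (ρ_ M.X).inv ≫ M.X ◁ η[B] ≫ M.act ≫ Hom.hom g := by rw [h']
    rwa [reassoc_of% M.act_one, reassoc_of% M.act_one, Iso.inv_hom_id_assoc,
      Iso.inv_hom_id_assoc] at this

/-- The presentation of a module by free modules is a coequalizer. -/
def isColimitBar (M : RightMod B) :
    IsColimit (Cofork.ofπ (counit M) (bar_condition M)) :=
  Cofork.IsColimit.mk' _ fun s => ⟨barDesc s.π s.condition, counit_barDesc _ _,
    fun {_} hm => (cancel_epi (counit M)).1 (hm.trans (counit_barDesc _ s.condition).symm)⟩

end RightMod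

end

/-! ### Right modules and monoidal functors -/

section

universe v₁ v₂ u₁ u₂

namespace RightMod

section

variable {Z : Type u₁} [Category.{v₁} Z] [MonoidalCategory Z]
    {E : Type u} [Category.{v} E] [MonoidalCategory E] (F : Z ⥤ E) (A : Z) [MonObj A]

open Functor.LaxMonoidal

/-- The functor between categories of right modules induced by a lax monoidal functor. -/
@[simps]
def mapMod [F.LaxMonoidal] : RightMod A ⥤ RightMod (F.obj A) where
  obj M :=
    { X := F.obj M.X
      act := Functor.LaxMonoidal.μ F M.X A ≫ F.map M.act
      act_one := by
        rw [Functor.obj.η_def, whiskerLeft_comp, Category.assoc, μ_natural_right_assoc,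
          ← F.map_comp, M.act_one, ← right_unitality]
      act_mul := by
        rw [Functor.obj.μ_def, whiskerLeft_comp, Category.assoc, μ_natural_right_assoc,
          ← F.map_comp, M.act_mul, F.map_comp, F.map_comp, comp_whiskerRight, Category.assoc,
          μ_natural_left_assoc, associativity_inv_assoc] }
  map {M N} f := ⟨F.map (Hom.hom f), by
    change (Functor.LaxMonoidal.μ F M.X A ≫ F.map M.act) ≫ F.map (Hom.hom f) =
      F.map (Hom.hom f) ▷ F.obj A ≫ Functor.LaxMonoidal.μ F N.X A ≫ F.map N.act
    rw [μ_natural_left_assoc, ← F.map_comp, Category.assoc, ← F.map_comp, Hom.act_hom]⟩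
  map_id M := hom_ext (F.map_id _)
  map_comp f g := hom_ext (F.map_comp _ _)

variable [F.Monoidal]

/-- A monoidal functor commutes with the action on right modules. -/
def mapModTensorIso (z : Z) (M : RightMod A) :
    tensorMod (F.obj z) ((mapMod F A).obj M) ≅ (mapMod F A).obj (tensorMod z M) :=
  isoMk (Functor.Monoidal.μIso F z M.X) (by
    change ((α_ (F.obj z) (F.obj M.X) (F.obj A)).hom ≫
        F.obj z ◁ (Functor.LaxMonoidal.μ F _ _ ≫ F.map M.act)) ≫
      Functor.LaxMonoidal.μ F z M.X = Functor.LaxMonoidal.μ F z M.X ▷ F.obj A ≫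
        Functor.LaxMonoidal.μ F _ _ ≫ F.map ((α_ z M.X A).hom ≫ z ◁ M.act)
    simp)

/-- A monoidal functor commutes with free right modules. -/
def mapModFreeIso (z : Z) :
    (free (F.obj A)).obj (F.obj z) ≅ (mapMod F A).obj ((free A).obj z) :=
  isoMk (Functor.Monoidal.μIso F z A) (by
    change ((α_ (F.obj z) (F.obj A) (F.obj A)).hom ≫
        F.obj z ◁ (Functor.LaxMonoidal.μ F _ _ ≫ F.map μ[A])) ≫
      Functor.LaxMonoidal.μ F z A = Functor.LaxMonoidal.μ F z A ▷ F.obj A ≫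
        Functor.LaxMonoidal.μ F _ _ ≫ F.map ((α_ z A A).hom ≫ z ◁ μ[A])
    simp)

theorem mapModFreeIso_hom_naturality {z z' : Z} (f : z ⟶ z') :
    (free (F.obj A)).map (F.map f) ≫ (mapModFreeIso F A z').hom =
      (mapModFreeIso F A z).hom ≫ (mapMod F A).map ((free A).map f) :=
  hom_ext (μ_natural_left F f A)

theorem freeMul_mapModFreeIso_hom (z : Z) :
    freeMul (F.obj A) (F.obj z) ≫ (mapModFreeIso F A z).hom =
      (free (F.obj A)).map (Functor.LaxMonoidal.μ F z A) ≫ (mapModFreeIso F A (z ⊗ A)).hom ≫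
        (mapMod F A).map (freeMul A z) :=
  (counit_naturality (mapModFreeIso F A z).hom).symm

end

section

variable {C : Type u₁} [Category.{v₁} C] [MonoidalCategory C]
    {D : Type u₂} [Category.{v₂} D] [MonoidalCategory D]
    (B : C) [MonObj B] (B' : D) [MonObj B']

/-- A pair of right modules is a right module in the product category. -/
@[simps]
def prodMod : RightMod B × RightMod B' ⥤ RightMod ((B, B') : C × D) where
  obj M :=
    { X := (M.1.X, M.2.X)
      act := M.1.act ×ₘ M.2.act
      act_one := Prod.ext M.1.act_one M.2.act_one
      act_mul := Prod.ext M.1.act_mul M.2.act_mul }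
  map f := ⟨Hom.hom f.1 ×ₘ Hom.hom f.2, Prod.ext (Hom.act_hom f.1) (Hom.act_hom f.2)⟩

variable {E : Type u} [Category.{v} E] [MonoidalCategory E] (F : C × D ⥤ E)

/-- The functor `(M, N) ↦ M ⊠ N` on right modules, with values in the right modules over
`B ⊠ B'`. -/
@[simps!]
def boxMod [F.LaxMonoidal] : RightMod B × RightMod B' ⥤ RightMod (F.obj (B, B')) :=
  prodMod B B' ⋙ mapMod F (B, B')

variable [F.Monoidal]

/-- The functor `boxMod` commutes with free modules. -/
def boxModFreeIso (c : C) (d : D) : (free (F.obj (B, B'))).obj (F.obj (c, d)) ≅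
    (boxMod B B' F).obj ((free B).obj c, (free B').obj d) :=
  mapModFreeIso F (B, B') (c, d)

theorem boxModFreeIso_hom_naturality {c c' : C} {d d' : D} (f : c ⟶ c') (g : d ⟶ d') :
    (free (F.obj (B, B'))).map (F.map (f ×ₘ g)) ≫ (boxModFreeIso B B' F c' d').hom =
      (boxModFreeIso B B' F c d).hom ≫
        (boxMod B B' F).map ((free B).map f ×ₘ (free B').map g) :=
  mapModFreeIso_hom_naturality F (B, B') (f ×ₘ g)

theorem freeMul_boxModFreeIso_hom (c : C) (d : D) :
    freeMul (F.obj (B, B')) (F.obj (c, d)) ≫ (boxModFreeIso B B' F c d).hom =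
      (free (F.obj (B, B'))).map (Functor.LaxMonoidal.μ F (c, d) (B, B')) ≫
        (boxModFreeIso B B' F (c ⊗ B) (d ⊗ B')).hom ≫
          (boxMod B B' F).map (freeMul B c ×ₘ freeMul B' d) :=
  freeMul_mapModFreeIso_hom F (B, B') (c, d)

end

section

variable {k : Type w} [Field k]
    {C : Type u₁} [Category.{v₁} C] [Abelian C] [Linear k C]
    [MonoidalCategory C] [MonoidalPreadditive C] [MonoidalLinear k C]
    {D : Type u₂} [Category.{v₂} D] [Abelian D] [Linear k D]
    [MonoidalCategory D] [MonoidalPreadditive D] [MonoidalLinear k D]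
    {E : Type u} [Category.{v} E] [Abelian E] [Linear k E]
    [MonoidalCategory E] [MonoidalPreadditive E] [MonoidalLinear k E]
    (B : C) [MonObj B] (B' : D) [MonObj B'] {F : C × D ⥤ E}

theorem isRightExactBilinear_boxMod [F.LaxMonoidal] [PreservesFiniteColimits (tensorRight B)]
    [PreservesFiniteColimits (tensorRight B')]
    [PreservesFiniteColimits (tensorRight (F.obj (B, B')))] (hF : IsRightExactBilinear k F) :
    IsRightExactBilinear k (boxMod B B' F) := by
  have h : IsRightExactBilinear k (boxMod B B' F ⋙ forget (F.obj (B, B'))) :=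
    IsRightExactBilinear.prod_comp (isRightExactLinear_forget B) (isRightExactLinear_forget B') hF
  exact ⟨fun n => isRightExactLinear_of_comp_forget (h.left n),
    fun m => isRightExactLinear_of_comp_forget (h.right m)⟩

theorem isRightExactBilinear_curriedAction (hE : IsRightExactBilinear k (tensor E)) (A : E)
    [MonObj A] :
    IsRightExactBilinear k
      (Functor.uncurry.obj (MonoidalLeftAction.curriedAction E (RightMod A))) := by
  have : PreservesFiniteColimits (tensorRight A) :=
    (isRightExactLinear_tensorRight hE A).rightExact
  exact IsRightExactBilinear.of_obj
    (fun e => isRightExactLinear_of_comp_forget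
      ((isRightExactLinear_forget A).comp k (isRightExactLinear_tensorLeft hE e)))
    (fun M => isRightExactLinear_of_comp_forget (isRightExactLinear_tensorRight hE M.X))

/-- The action of `E` on the right modules over `B ⊠ B'` is induced by the actions on the right
modules over `B` and `B'`. -/
def inducedActionBoxMod [F.Monoidal] (hE : IsRightExactBilinear k (tensor E)) :
    InducedAction k F (boxMod B B' F) where
  bilinear := isRightExactBilinear_curriedAction hE _
  iso c d m n := mapModTensorIso F (B, B') (c, d) ((prodMod B B').obj (m, n))
  naturality f g a b :=
    hom_ext (Functor.LaxMonoidal.μ_natural F (f ×ₘ g) (Hom.hom a ×ₘ Hom.hom b))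
  associativity c c' d d' m n :=
    hom_ext (Functor.LaxMonoidal.associativity F (c, d) (c', d') (m.X, n.X))
  unitality m n := hom_ext (Functor.LaxMonoidal.left_unitality F (m.X, n.X)).symm

end

end RightMod

end

/-! ### The Deligne product of categories of right modules -/

section

universe v₁ v₂ v₃ u₁ u₂ u₃

variable {k : Type w} [Field k]

section

variable {T : Type u₁} [Category.{v₁} T] [Preadditive T] [Linear k T]
    {X : Type u} [Category.{v} X] [Preadditive X] [Linear k X] [HasFiniteColimits X]
    {H₁ H₂ : T ⥤ X}

/-- A coequalizer of right exact linear functors is right exact linear. -/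
theorem IsRightExactLinear.coequalizer (h₁ : IsRightExactLinear k H₁)
    (h₂ : IsRightExactLinear k H₂) (a b : H₁ ⟶ H₂) :
    IsRightExactLinear k (Limits.coequalizer a b) := by
  have epi_app (t : T) : Epi ((coequalizer.π a b).app t) := inferInstance
  have nat {t t' : T} (f : t ⟶ t') := (coequalizer.π a b).naturality f
  refine ⟨⟨fun {t t' f g} => ?_⟩, ⟨fun {t t'} f r => ?_⟩, ⟨fun J _ _ => ?_⟩⟩
  · rw [← cancel_epi ((coequalizer.π a b).app t), Preadditive.comp_add, ← nat, ← nat, ← nat,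
      h₂.additive.map_add, Preadditive.add_comp]
  · rw [← cancel_epi ((coequalizer.π a b).app t), Linear.comp_smul, ← nat, ← nat,
      h₂.linear.map_smul, Linear.smul_comp]
  · have := h₁.rightExact
    have := h₂.rightExact
    have : PreservesColimitsOfShape J (parallelPair a b).flip :=
      preservesColimitsOfShape_of_evaluation _ _ fun j => by
        cases j
        · exact inferInstanceAs (PreservesColimitsOfShape J H₁)
        · exact inferInstanceAs (PreservesColimitsOfShape J H₂)
    exact preservesColimitsOfShape_of_natIso (colimitIsoFlipCompColim (parallelPair a b)).symm

end

/-- A functor that preserves coequalizers: the induced morphisms. -/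
theorem exists_desc_of_preservesFiniteColimits {M : Type u₁} [Category.{v₁} M]
    {X : Type u} [Category.{v} X] (H : M ⥤ X) [PreservesFiniteColimits H]
    {a₁ a₀ a : M} {f g : a₁ ⟶ a₀} {p : a₀ ⟶ a} {hp : f ≫ p = g ≫ p}
    (c : IsColimit (Cofork.ofπ p hp)) {Z : X} (φ : H.obj a₀ ⟶ Z)
    (hφ : H.map f ≫ φ = H.map g ≫ φ) : ∃ ψ, H.map p ≫ ψ = φ := by
  let l := isColimitCoforkMapOfIsColimit H hp c
  exact ⟨(Cofork.IsColimit.desc' l φ hφ).1, (Cofork.IsColimit.desc' l φ hφ).2⟩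

section

variable {M : Type u₁} [Category.{v₁} M] [Preadditive M] [Linear k M]
    {N : Type u₂} [Category.{v₂} N] [Preadditive N] [Linear k N]
    {X : Type u} [Category.{v} X] [Preadditive X] [Linear k X] {G : M × N ⥤ X}

namespace IsRightExactBilinear

theorem epi_map (hG : IsRightExactBilinear k G) {a₀ a : M} {b₀ b : N} (p : a₀ ⟶ a) (q : b₀ ⟶ b)
    [Epi p] [Epi q] : Epi (G.map (p ×ₘ q)) := by
  have := (hG.left b₀).rightExact
  have := (hG.right a).rightExact
  have h₁ : Epi (G.map (p ×ₘ 𝟙 b₀)) := inferInstanceAs (Epi ((Prod.sectL M b₀ ⋙ G).map p))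
  have h₂ : Epi (G.map (𝟙 a ×ₘ q)) := inferInstanceAs (Epi ((Prod.sectR a N ⋙ G).map q))
  have : G.map (p ×ₘ q) = G.map (p ×ₘ 𝟙 b₀) ≫ G.map (𝟙 a ×ₘ q) := by simp [← G.map_comp]
  rw [this]
  infer_instance

/-- A right exact bilinear functor preserves reflexive coequalizers: the induced morphisms. -/
theorem exists_desc (hG : IsRightExactBilinear k G)
    {a₁ a₀ a : M} {f g : a₁ ⟶ a₀} {s : a₀ ⟶ a₁} (sf : s ≫ f = 𝟙 a₀) (sg : s ≫ g = 𝟙 a₀)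
    {p : a₀ ⟶ a} {hp : f ≫ p = g ≫ p} (c : IsColimit (Cofork.ofπ p hp))
    {b₁ b₀ b : N} {f' g' : b₁ ⟶ b₀} {s' : b₀ ⟶ b₁} (sf' : s' ≫ f' = 𝟙 b₀)
    (sg' : s' ≫ g' = 𝟙 b₀) {p' : b₀ ⟶ b} {hp' : f' ≫ p' = g' ≫ p'}
    (c' : IsColimit (Cofork.ofπ p' hp')) {Z : X} (φ : G.obj (a₀, b₀) ⟶ Z)
    (hφ : G.map (f ×ₘ f') ≫ φ = G.map (g ×ₘ g') ≫ φ) :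
    ∃ ψ, G.map (p ×ₘ p') ≫ ψ = φ := by
  have : Epi p := ⟨fun u v h => Cofork.IsColimit.hom_ext c h⟩
  have e₁ : G.map (f ×ₘ 𝟙 b₀) ≫ φ = G.map (g ×ₘ 𝟙 b₀) ≫ φ := by
    have := congrArg (fun z => G.map (𝟙 a₁ ×ₘ s') ≫ z) hφ
    simpa [← G.map_comp_assoc, sf', sg'] using this
  have e₂ : G.map (𝟙 a₀ ×ₘ f') ≫ φ = G.map (𝟙 a₀ ×ₘ g') ≫ φ := by
    have := congrArg (fun z => G.map (s ×ₘ 𝟙 b₁) ≫ z) hφ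
    simpa [← G.map_comp_assoc, sf, sg] using this
  have := (hG.left b₀).rightExact
  have := (hG.right a).rightExact
  obtain ⟨χ, hχ⟩ : ∃ χ, G.map (p ×ₘ 𝟙 b₀) ≫ χ = φ :=
    exists_desc_of_preservesFiniteColimits (Prod.sectL M b₀ ⋙ G) c φ e₁
  obtain ⟨ψ, hψ⟩ : ∃ ψ, G.map (𝟙 a ×ₘ p') ≫ ψ = χ := by
    refine exists_desc_of_preservesFiniteColimits (Prod.sectR a N ⋙ G) c' χ ?_
    change G.map (𝟙 a ×ₘ f') ≫ χ = G.map (𝟙 a ×ₘ g') ≫ χ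
    have := hG.epi_map p (𝟙 b₁)
    rw [← cancel_epi (G.map (p ×ₘ 𝟙 b₁)), reassoc_of% map_prod_exchange G p f',
      reassoc_of% map_prod_exchange G p g', hχ, e₂]
  refine ⟨ψ, ?_⟩
  rw [← hχ, ← hψ, ← G.map_comp_assoc]
  simp

end IsRightExactBilinear

end

namespace RightMod

section

variable {C : Type u₁} [Category.{v₁} C] [Abelian C] [Linear k C]
    [MonoidalCategory C]
    {D : Type u₂} [Category.{v₂} D] [Abelian D] [Linear k D]
    [MonoidalCategory D]
    {E : Type (max u v)} [Category.{v} E] [Abelian E] [Linear k E]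
    [MonoidalCategory E] [MonoidalPreadditive E] [MonoidalLinear k E]
    {B : C} [MonObj B] {B' : D} [MonObj B'] {F : C × D ⥤ E}

variable [F.Monoidal] [PreservesFiniteColimits (tensorRight (F.obj (B, B')))]
    {X : Type (max u v)} [Category.{v} X] [Abelian X] [Linear k X]
    {H H' : RightMod (F.obj (B, B')) ⥤ X}

theorem boxMod_natTrans_ext (hF : IsDeligneProduct k F) (hH : IsRightExactLinear k H)
    (hH' : IsRightExactLinear k H') (α β : H ⟶ H')
    (h : ∀ x, α.app ((boxMod B B' F).obj x) = β.app ((boxMod B B' F).obj x)) : α = β := by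
  have key : Functor.whiskerLeft (free (F.obj (B, B'))) α = Functor.whiskerLeft _ β :=
    hF.natTrans_ext ((isRightExactLinear_free _).comp k hH) ((isRightExactLinear_free _).comp k hH') _ _
      fun x => by
        let θ := boxModFreeIso B B' F x.1 x.2
        change α.app ((free _).obj (F.obj x)) = β.app ((free _).obj (F.obj x))
        have hα := α.naturality θ.hom
        have hβ := β.naturality θ.hom
        rw [h] at hα
        rw [← cancel_mono (H'.map θ.hom)]
        exact hα.symm.trans hβ
  ext M
  have := hH.rightExact
  rw [← cancel_epi (H.map (counit M)), α.naturality, β.naturality]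
  exact congrArg (· ≫ _) (NatTrans.congr_app key M.X)

theorem boxMod_exists_natTrans (hE : IsRightExactBilinear k (tensor E))
    (hF : IsDeligneProduct k F) (hH : IsRightExactLinear k H)
    (hH' : IsRightExactLinear k H') (t : boxMod B B' F ⋙ H ⟶ boxMod B B' F ⋙ H') :
    ∃ α : H ⟶ H', ∀ x, α.app ((boxMod B B' F).obj x) = t.app x := by
  obtain ⟨g, hg, hgt⟩ : ∃ g : ∀ m n, H.obj ((boxMod B B' F).obj (m, n)) ⟶
      H'.obj ((boxMod B B' F).obj (m, n)), (∀ {m m' n n'} (a : m ⟶ m') (b : n ⟶ n'),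
        H.map ((boxMod B B' F).map (a ×ₘ b)) ≫ g m' n' =
          g m n ≫ H'.map ((boxMod B B' F).map (a ×ₘ b))) ∧ ∀ m n, t.app (m, n) = g m n :=
    ⟨fun m n => t.app (m, n), fun a b => t.naturality (a ×ₘ b), fun _ _ => rfl⟩
  let A := F.obj (B, B')
  let θ (c : C) (d : D) := boxModFreeIso B B' F c d
  have hθ {c c' : C} {d d' : D} (f : c ⟶ c') (f' : d ⟶ d') :
      (free A).map (F.map (f ×ₘ f')) ≫ (θ c' d').hom =
        (θ c d).hom ≫ (boxMod B B' F).map ((free B).map f ×ₘ (free B').map f') :=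
    boxModFreeIso_hom_naturality B B' F f f'
  have hFree : IsRightExactLinear k (free A) := isRightExactLinear_free A
  obtain ⟨δ, hδ⟩ : ∃ δ : ∀ e, H.obj ((free A).obj e) ⟶ H'.obj ((free A).obj e),
      (∀ {e e'} (f : e ⟶ e'), H.map ((free A).map f) ≫ δ e' = δ e ≫ H'.map ((free A).map f)) ∧
      ∀ c d, δ (F.obj (c, d)) ≫ H'.map (θ c d).hom =
        H.map (θ c d).hom ≫ g ((free B).obj c) ((free B').obj d) := by
    have nat {c c' : C} {d d' : D} (f : c ⟶ c') (f' : d ⟶ d') :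
        H.map ((free A).map (F.map (f ×ₘ f'))) ≫ H.map (θ c' d').hom ≫ g _ _ ≫
          H'.map (θ c' d').inv = (H.map (θ c d).hom ≫ g _ _ ≫ H'.map (θ c d).inv) ≫
            H'.map ((free A).map (F.map (f ×ₘ f'))) := by
      have : (free A).map (F.map (f ×ₘ f')) = (θ c d).hom ≫
          (boxMod B B' F).map ((free B).map f ×ₘ (free B').map f') ≫ (θ c' d').inv := by
        rw [← reassoc_of% hθ, Iso.hom_inv_id, Category.comp_id]
      rw [this]
      simp only [Functor.map_comp, Category.assoc, Iso.map_inv_hom_id_assoc, reassoc_of% hg]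
    obtain ⟨δ, hδ⟩ := hF.exists_natTrans (hFree.comp k hH) (hFree.comp k hH')
      { app x := H.map (θ x.1 x.2).hom ≫ g _ _ ≫ H'.map (θ x.1 x.2).inv
        naturality x x' f := nat f.1 f.2 }
    refine ⟨fun e => δ.app e, fun f => δ.naturality f, fun c d => ?_⟩
    have h : (H.map (θ c d).hom ≫ g _ _ ≫ H'.map (θ c d).inv) ≫ H'.map (θ c d).hom =
        H.map (θ c d).hom ≫ g _ _ := by simp
    exact (congrArg (· ≫ H'.map (θ c d).hom) (hδ (c, d))).trans h
  obtain ⟨δnat, hδ⟩ := hδ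
  have hmul (e : E) : H.map (freeMul A e) ≫ δ e = δ (e ⊗ A) ≫ H'.map (freeMul A e) := by
    have hr := isRightExactLinear_tensorRight hE A
    let l : tensorRight A ⋙ free A ⋙ H ⟶ free A ⋙ H' :=
      { app e := H.map (freeMul A e) ≫ δ e
        naturality e e' f := by
          change H.map ((free A).map (f ▷ A)) ≫ H.map (freeMul A e') ≫ δ e' =
            (H.map (freeMul A e) ≫ δ e) ≫ H'.map ((free A).map f)
          rw [← H.map_comp_assoc, freeMul_naturality, H.map_comp_assoc, δnat, Category.assoc] }
    let r : tensorRight A ⋙ free A ⋙ H ⟶ free A ⋙ H' :=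
      { app e := δ (e ⊗ A) ≫ H'.map (freeMul A e)
        naturality e e' f := by
          change H.map ((free A).map (f ▷ A)) ≫ δ (e' ⊗ A) ≫ H'.map (freeMul A e') =
            (δ (e ⊗ A) ≫ H'.map (freeMul A e)) ≫ H'.map ((free A).map f)
          rw [reassoc_of% δnat, Category.assoc, ← H'.map_comp, ← H'.map_comp,
            freeMul_naturality] }
    refine NatTrans.congr_app (hF.natTrans_ext (hr.comp k (hFree.comp k hH)) (hFree.comp k hH')
      l r fun x => ?_) e
    obtain ⟨c, d⟩ := x
    change H.map (freeMul A (F.obj (c, d))) ≫ δ (F.obj (c, d)) =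
      δ (F.obj (c, d) ⊗ A) ≫ H'.map (freeMul A (F.obj (c, d)))
    have hm : freeMul A (F.obj (c, d)) ≫ (θ c d).hom =
      (free A).map (Functor.LaxMonoidal.μ F (c, d) (B, B')) ≫
        (θ (c ⊗ B) (d ⊗ B')).hom ≫
          (boxMod B B' F).map (freeMul B c ×ₘ freeMul B' d) := freeMul_boxModFreeIso_hom B B' F c d
    have hδm := δnat (Functor.LaxMonoidal.μ F (c, d) (B, B'))
    dsimp only [prodMonoidal_tensorObj] at hδm hm
    rw [← cancel_mono (H'.map (θ c d).hom), Category.assoc, Category.assoc, hδ,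
      ← H.map_comp_assoc, ← H'.map_comp, hm]
    simp only [Functor.map_comp, Category.assoc]
    rw [← reassoc_of% hδm, reassoc_of% hδ, hg]
  have := hH.rightExact
  have hα (M : RightMod A) : ∃ α : H.obj M ⟶ H'.obj M,
      H.map (counit M) ≫ α = δ M.X ≫ H'.map (counit M) := by
    refine exists_desc_of_preservesFiniteColimits H (isColimitBar M) _ ?_
    rw [reassoc_of% δnat, ← H'.map_comp, bar_condition, H'.map_comp, ← reassoc_of% hmul]
  choose α hα using hα
  refine ⟨{ app := α, naturality := fun M M' f => ?_ }, fun x => ?_⟩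
  · rw [← cancel_epi (H.map (counit M)), ← H.map_comp_assoc, ← counit_naturality,
      H.map_comp_assoc, hα, reassoc_of% δnat, ← H'.map_comp, counit_naturality, H'.map_comp,
      reassoc_of% hα]
  · obtain ⟨m, n⟩ := x
    have h : δ (F.obj (m.X, n.X)) ≫
        H'.map ((θ m.X n.X).hom ≫ (boxMod B B' F).map (counit m ×ₘ counit n)) =
          H.map ((θ m.X n.X).hom ≫ (boxMod B B' F).map (counit m ×ₘ counit n)) ≫ g m n := by
      rw [H.map_comp, H'.map_comp, Category.assoc, hg, reassoc_of% hδ]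
    rw [hgt, ← cancel_epi (H.map (counit ((boxMod B B' F).obj (m, n))))]
    exact (hα _).trans h

end

end RightMod

end

section

universe v₁ v₂ v₃ u₁ u₂ u₃

variable {k : Type w} [Field k]

namespace RightMod

section

variable {C : Type u} [Category.{v} C] [MonoidalCategory C] (B : C) [MonObj B]

/-- The common section of the two morphisms in the presentation of a module. -/
def freeSection (M : RightMod B) : (free B).obj M.X ⟶ (free B).obj (M.X ⊗ B) :=
  (free B).map ((ρ_ M.X).inv ≫ M.X ◁ η[B])

variable {B}

theorem freeSection_act (M : RightMod B) :
    freeSection B M ≫ (free B).map M.act = 𝟙 _ := by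
  rw [freeSection, ← (free B).map_comp, Category.assoc, M.act_one, Iso.inv_hom_id,
    (free B).map_id]

theorem freeSection_freeMul (M : RightMod B) :
    freeSection B M ≫ freeMul B M.X = 𝟙 _ := by
  apply hom_ext
  change ((ρ_ M.X).inv ≫ M.X ◁ η[B]) ▷ B ≫ (α_ M.X B B).hom ≫ M.X ◁ μ[B] = 𝟙 (M.X ⊗ B)
  rw [comp_whiskerRight, Category.assoc, associator_naturality_middle_assoc,
    ← whiskerLeft_comp, MonObj.one_mul]
  simp

end

section

variable {C : Type u₁} [Category.{v₁} C] [Abelian C] [Linear k C]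
    [MonoidalCategory C] [MonoidalPreadditive C] [MonoidalLinear k C]
    {D : Type u₂} [Category.{v₂} D] [Abelian D] [Linear k D]
    [MonoidalCategory D] [MonoidalPreadditive D] [MonoidalLinear k D]
    {E : Type (max u v)} [Category.{v} E] [Abelian E] [Linear k E]
    [MonoidalCategory E] [MonoidalPreadditive E] [MonoidalLinear k E]
    {B : C} [MonObj B] {B' : D} [MonObj B'] {F : C × D ⥤ E}
    [F.Monoidal] [PreservesFiniteColimits (tensorRight (F.obj (B, B')))]
    [PreservesFiniteColimits (tensorRight B)] [PreservesFiniteColimits (tensorRight B')]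
    {X : Type (max u v)} [Category.{v} X] [Abelian X] [Linear k X]

theorem boxMod_exists_extension (hE : IsRightExactBilinear k (tensor E))
    (hF : IsDeligneProduct k F) {G : RightMod B × RightMod B' ⥤ X}
    (hG : IsRightExactBilinear k G) :
    ∃ H : RightMod (F.obj (B, B')) ⥤ X, IsRightExactLinear k H ∧
      Nonempty (boxMod B B' F ⋙ H ≅ G) := by
  let A := F.obj (B, B')
  have hG₀ : IsRightExactBilinear k ((free B).prod (free B') ⋙ G) :=
    hG.prod_comp (isRightExactLinear_free B) (isRightExactLinear_free B')
  obtain ⟨G₀, hG₀, ⟨t₀⟩⟩ := hF.exists_extension hG₀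
  obtain ⟨t, ht⟩ : ∃ t : ∀ c d, G₀.obj (F.obj (c, d)) ≅ G.obj ((free B).obj c, (free B').obj d),
      ∀ {c c' d d'} (f : c ⟶ c') (f' : d ⟶ d'), G₀.map (F.map (f ×ₘ f')) ≫ (t c' d').hom =
        (t c d).hom ≫ G.map ((free B).map f ×ₘ (free B').map f') :=
    ⟨fun c d => t₀.app (c, d), fun f f' => t₀.hom.naturality (f ×ₘ f')⟩
  have hr := isRightExactLinear_tensorRight hE A
  obtain ⟨τ, hτ⟩ : ∃ τ : tensorRight A ⋙ G₀ ⟶ G₀, ∀ c d,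
      τ.app (F.obj (c, d)) ≫ (t c d).hom =
        G₀.map (Functor.LaxMonoidal.μ F (c, d) (B, B')) ≫ (t (c ⊗ B) (d ⊗ B')).hom ≫
          G.map (freeMul B c ×ₘ freeMul B' d) := by
    have nat {c c' : C} {d d' : D} (f : c ⟶ c') (f' : d ⟶ d') :
        G₀.map (F.map (f ×ₘ f') ▷ A) ≫ G₀.map (Functor.LaxMonoidal.μ F (c', d') (B, B')) ≫
          (t (c' ⊗ B) (d' ⊗ B')).hom ≫ G.map (freeMul B c' ×ₘ freeMul B' d') ≫ (t c' d').inv =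
        (G₀.map (Functor.LaxMonoidal.μ F (c, d) (B, B')) ≫ (t (c ⊗ B) (d ⊗ B')).hom ≫
          G.map (freeMul B c ×ₘ freeMul B' d) ≫ (t c d).inv) ≫ G₀.map (F.map (f ×ₘ f')) := by
      have h₁ : F.map (f ×ₘ f') ▷ A ≫ Functor.LaxMonoidal.μ F (c', d') (B, B') =
          Functor.LaxMonoidal.μ F (c, d) (B, B') ≫ F.map ((f ▷ B) ×ₘ (f' ▷ B')) :=
        Functor.LaxMonoidal.μ_natural_left F (f ×ₘ f') (B, B')
      have h₂ : G.map ((free B).map (f ▷ B) ×ₘ (free B').map (f' ▷ B')) ≫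
          G.map (freeMul B c' ×ₘ freeMul B' d') =
            G.map (freeMul B c ×ₘ freeMul B' d) ≫ G.map ((free B).map f ×ₘ (free B').map f') := by
        rw [← G.map_comp, ← G.map_comp, prod_comp, prod_comp, freeMul_naturality,
          freeMul_naturality]
      have h₃ : G.map ((free B).map f ×ₘ (free B').map f') ≫ (t c' d').inv =
          (t c d).inv ≫ G₀.map (F.map (f ×ₘ f')) := by
        rw [Iso.comp_inv_eq, Category.assoc, ht, Iso.inv_hom_id_assoc]
      have h₄ := ht (f ▷ B) (f' ▷ B')
      dsimp only [prodMonoidal_tensorObj] at h₁ ⊢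
      rw [← G₀.map_comp_assoc, h₁, G₀.map_comp_assoc, reassoc_of% h₄, reassoc_of% h₂, h₃]
      simp only [Category.assoc]
    obtain ⟨τ, hτ⟩ := hF.exists_natTrans (hr.comp k hG₀) hG₀
      { app x := G₀.map (Functor.LaxMonoidal.μ F x (B, B')) ≫
          (t (x.1 ⊗ B) (x.2 ⊗ B')).hom ≫ G.map (freeMul B x.1 ×ₘ freeMul B' x.2) ≫
            (t x.1 x.2).inv
        naturality x x' f := nat f.1 f.2 }
    refine ⟨τ, fun c d => ?_⟩
    have h : (G₀.map (Functor.LaxMonoidal.μ F (c, d) (B, B')) ≫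
        (t (c ⊗ B) (d ⊗ B')).hom ≫ G.map (freeMul B c ×ₘ freeMul B' d) ≫ (t c d).inv) ≫
          (t c d).hom = G₀.map (Functor.LaxMonoidal.μ F (c, d) (B, B')) ≫
            (t (c ⊗ B) (d ⊗ B')).hom ≫ G.map (freeMul B c ×ₘ freeMul B' d) := by
      dsimp only [prodMonoidal_tensorObj]
      simp
    exact (congrArg (· ≫ (t c d).hom) (hτ (c, d))).trans h
  let a : forget A ⋙ tensorRight A ⋙ G₀ ⟶ forget A ⋙ G₀ := Functor.whiskerLeft (forget A) τ
  let b : forget A ⋙ tensorRight A ⋙ G₀ ⟶ forget A ⋙ G₀ :=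
    { app M := G₀.map M.act
      naturality M M' f := by
        change G₀.map (Hom.hom f ▷ A) ≫ G₀.map M'.act = G₀.map M.act ≫ G₀.map (Hom.hom f)
        rw [← G₀.map_comp, ← G₀.map_comp, Hom.act_hom] }
  have hU : IsRightExactLinear k (forget A) := isRightExactLinear_forget A
  let H := coequalizer a b
  have hH : IsRightExactLinear k H :=
    IsRightExactLinear.coequalizer (hU.comp k (hr.comp k hG₀)) (hU.comp k hG₀) a b
  obtain ⟨π, πepi, πnat, πcond, πdesc⟩ : ∃ π : ∀ M : RightMod A, G₀.obj M.X ⟶ H.obj M,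
      (∀ M, Epi (π M)) ∧
      (∀ {M M'} (f : M ⟶ M'), G₀.map (Hom.hom f) ≫ π M' = π M ≫ H.map f) ∧
      (∀ M, τ.app M.X ≫ π M = G₀.map M.act ≫ π M) ∧
      ∀ (M : RightMod A) {Z : X} (φ : G₀.obj M.X ⟶ Z), τ.app M.X ≫ φ = G₀.map M.act ≫ φ →
        ∃ ψ, π M ≫ ψ = φ := by
    refine ⟨fun M => (coequalizer.π a b).app M, fun M => inferInstanceAs (Epi ((coequalizer.π a b).app M)),
      fun f => (coequalizer.π a b).naturality f,
      fun M => NatTrans.congr_app (coequalizer.condition a b) M, fun M Z φ hφ => ?_⟩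
    exact exists_desc_of_preservesFiniteColimits ((evaluation (RightMod A) X).obj M)
      (coequalizerIsCoequalizer a b) φ hφ
  refine ⟨H, hH, ?_⟩
  let q (m : RightMod B) (n : RightMod B') : G₀.obj (F.obj (m.X, n.X)) ⟶ G.obj (m, n) :=
    (t m.X n.X).hom ≫ G.map (counit m ×ₘ counit n)
  have qepi (m n) : Epi (q m n) := by
    have := hG.epi_map (counit m) (counit n)
    infer_instance
  have qcond (m : RightMod B) (n : RightMod B') : τ.app (F.obj (m.X, n.X)) ≫ q m n =
      G₀.map ((boxMod B B' F).obj (m, n)).act ≫ q m n := by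
    have h : G.map (freeMul B m.X ×ₘ freeMul B' n.X) ≫ G.map (counit m ×ₘ counit n) =
        G.map ((free B).map m.act ×ₘ (free B').map n.act) ≫ G.map (counit m ×ₘ counit n) := by
      rw [← G.map_comp, ← G.map_comp, prod_comp, prod_comp, bar_condition, bar_condition]
    have h' := ht m.act n.act
    change τ.app (F.obj (m.X, n.X)) ≫ (t m.X n.X).hom ≫ G.map (counit m ×ₘ counit n) =
      G₀.map (Functor.LaxMonoidal.μ F (m.X, n.X) (B, B') ≫ F.map (m.act ×ₘ n.act)) ≫
        (t m.X n.X).hom ≫ G.map (counit m ×ₘ counit n)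
    dsimp only [prodMonoidal_tensorObj] at hτ ⊢
    rw [reassoc_of% hτ, h, G₀.map_comp, Category.assoc, reassoc_of% h']
  have qdesc (m : RightMod B) (n : RightMod B') {Z : X} (φ : G₀.obj (F.obj (m.X, n.X)) ⟶ Z)
      (hφ : τ.app (F.obj (m.X, n.X)) ≫ φ = G₀.map ((boxMod B B' F).obj (m, n)).act ≫ φ) :
      ∃ ψ, q m n ≫ ψ = φ := by
    obtain ⟨ψ, hψ⟩ := hG.exists_desc (freeSection_act m) (freeSection_freeMul m) (isColimitBar m)
      (freeSection_act n) (freeSection_freeMul n) (isColimitBar n) ((t m.X n.X).inv ≫ φ) (by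
        have h := hτ m.X n.X
        have h' := ht m.act n.act
        replace hφ : τ.app (F.obj (m.X, n.X)) ≫ φ =
          G₀.map (Functor.LaxMonoidal.μ F (m.X, n.X) (B, B') ≫ F.map (m.act ×ₘ n.act)) ≫ φ := hφ
        have : IsIso (G₀.map (Functor.LaxMonoidal.μ F (m.X, n.X) (B, B'))) := inferInstance
        dsimp only [prodMonoidal_tensorObj] at h hφ this
        rw [← cancel_epi (t (m.X ⊗ B) (n.X ⊗ B')).hom, ← reassoc_of% h', Iso.hom_inv_id_assoc,
          ← cancel_epi (G₀.map (Functor.LaxMonoidal.μ F (m.X, n.X) (B, B'))),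
          ← reassoc_of% h, Iso.hom_inv_id_assoc, hφ, G₀.map_comp, Category.assoc])
    exact ⟨ψ, by rw [Category.assoc, hψ, Iso.hom_inv_id_assoc]⟩
  have hiso (m : RightMod B) (n : RightMod B') :
      ∃ i : H.obj ((boxMod B B' F).obj (m, n)) ≅ G.obj (m, n), π _ ≫ i.hom = q m n := by
    obtain ⟨i, hi⟩ := πdesc ((boxMod B B' F).obj (m, n)) _ (qcond m n)
    obtain ⟨j, hj⟩ := qdesc m n _ (πcond ((boxMod B B' F).obj (m, n)))
    have := πepi ((boxMod B B' F).obj (m, n))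
    have := qepi m n
    refine ⟨⟨i, j, ?_, ?_⟩, hi⟩
    · rw [← cancel_epi (π _), ← Category.assoc, hi, Category.comp_id]
      exact hj
    · rw [← cancel_epi (q m n), ← Category.assoc, hj, Category.comp_id]
      exact hi
  choose i hi using hiso
  have qnat {m m' : RightMod B} {n n' : RightMod B'} (f : m ⟶ m') (f' : n ⟶ n') :
      G₀.map (F.map (Hom.hom f ×ₘ Hom.hom f')) ≫ q m' n' = q m n ≫ G.map (f ×ₘ f') := by
    have h : G.map ((free B).map (Hom.hom f) ×ₘ (free B').map (Hom.hom f')) ≫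
        G.map (counit m' ×ₘ counit n') = G.map (counit m ×ₘ counit n) ≫ G.map (f ×ₘ f') := by
      rw [← G.map_comp, ← G.map_comp, prod_comp, prod_comp, counit_naturality,
        counit_naturality]
    rw [reassoc_of% ht, h, Category.assoc]
  have inat {m m' : RightMod B} {n n' : RightMod B'} (f : m ⟶ m') (f' : n ⟶ n') :
      H.map ((boxMod B B' F).map (f ×ₘ f')) ≫ (i m' n').hom =
        (i m n).hom ≫ G.map (f ×ₘ f') := by
    have := πepi ((boxMod B B' F).obj (m, n))
    rw [← cancel_epi (π _), ← reassoc_of% πnat, hi, reassoc_of% hi]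
    exact qnat f f'
  exact ⟨NatIso.ofComponents (fun x => i x.1 x.2) (fun {x x'} f => inat f.1 f.2)⟩

end

end RightMod

end

theorem preservesFiniteColimits_tensorRight_of_hasRightDual {C : Type u} [Category.{v} C]
    [MonoidalCategory C] (B : C) [HasRightDual B] : PreservesFiniteColimits (tensorRight B) := by
  have := (tensorRightAdjunction B (Bᘁ)).leftAdjoint_preservesColimits
  infer_instance

/-- Right modules over `B ⊠ B'` form a Deligne product of the categories of right modules over `B`
and over `B'`. -/
theorem RightMod.isDeligneProduct_boxMod {k : Type w} [Field k]
    {C : Type (max u v)} [Category.{v} C] [Abelian C] [Linear k C]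
    [MonoidalCategory C] [MonoidalPreadditive C] [MonoidalLinear k C]
    {D : Type (max u v)} [Category.{v} D] [Abelian D] [Linear k D]
    [MonoidalCategory D] [MonoidalPreadditive D] [MonoidalLinear k D]
    {E : Type (max u v)} [Category.{v} E] [Abelian E] [Linear k E]
    [MonoidalCategory E] [MonoidalPreadditive E] [MonoidalLinear k E]
    (hE : IsRightExactBilinear k (tensor E))
    (F : C × D ⥤ E) [F.Monoidal] (hF : IsDeligneProduct k F)
    (B : C) [MonObj B] (B' : D) [MonObj B']
    [PreservesFiniteColimits (tensorRight B)] [PreservesFiniteColimits (tensorRight B')]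
    [PreservesFiniteColimits (tensorRight (F.obj (B, B')))] :
    letI := RightMod.abelian (F.obj (B, B'))
    IsDeligneProduct k (boxMod B B' F) :=
  letI := RightMod.abelian (F.obj (B, B'))
  IsDeligneProduct.mk' (isRightExactBilinear_boxMod B B' hF.bilinear)
    (fun _ _ _ _ _ _ hH hH' α β h => boxMod_natTrans_ext hF hH hH' α β h)
    (fun _ _ _ _ _ _ hH hH' t => boxMod_exists_natTrans hE hF hH hH' t)
    (fun _ _ _ _ _ hG => boxMod_exists_extension hE hF hG)

theorem mainTheorem7 {k : Type w} [Field k]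
    {C : Type (max u v)} [Category.{v} C] [Abelian C] [Linear k C]
    [MonoidalCategory C] [MonoidalPreadditive C] [MonoidalLinear k C] [RigidCategory C]
    {D : Type (max u v)} [Category.{v} D] [Abelian D] [Linear k D]
    [MonoidalCategory D] [MonoidalPreadditive D] [MonoidalLinear k D] [RigidCategory D]
    {E : Type (max u v)} [Category.{v} E] [Abelian E] [Linear k E]
    [MonoidalCategory E] [MonoidalPreadditive E] [MonoidalLinear k E]
    (hE : IsRightExactBilinear k (tensor E))
    (F : C × D ⥤ E) [F.Monoidal] (hF : IsDeligneProduct k F)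
    (B : C) [MonObj B] (B' : D) [MonObj B'] :
    (∃ (Q : Type (max u v)) (_ : Category.{v} Q) (_ : Abelian Q) (_ : Linear k Q)
      (P : RightMod B × RightMod B' ⥤ Q), IsDeligneProduct k P) ∧
    ∀ (Q : Type (max u v)) [Category.{v} Q] [Abelian Q] [Linear k Q]
      (P : RightMod B × RightMod B' ⥤ Q), IsDeligneProduct k P →
      (∃ _ : MonoidalLeftAction E Q, Nonempty (InducedAction k F P)) ∧
      ∀ [MonoidalLeftAction E Q], InducedAction k F P →
        ∃ e : Q ≌ RightMod (F.obj (B, B')),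
          e.functor.Additive ∧ e.functor.Linear k ∧ Nonempty (e.functor.LeftLinear E) := by
  have := preservesFiniteColimits_tensorRight_of_hasRightDual B
  have := preservesFiniteColimits_tensorRight_of_hasRightDual B'
  have := (isRightExactLinear_tensorRight hE (F.obj (B, B'))).rightExact
  let := RightMod.abelian (F.obj (B, B'))
  have hBox := RightMod.isDeligneProduct_boxMod hE F hF B B'
  refine ⟨⟨_, _, _, _, _, hBox⟩, fun Q _ _ _ P hP => ?_⟩
  obtain ⟨e, he, ⟨i⟩⟩ := hP.exists_equivalence hBox
  refine ⟨(RightMod.inducedActionBoxMod B B' hE).exists_transport e he i, fun I => ?_⟩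
  exact ⟨e, he.additive, he.linear,
    InducedAction.nonempty_leftLinear hE hF hP I (RightMod.inducedActionBoxMod B B' hE) he i⟩
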